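/- **Setting.** Let $\dot x(t)=f(x(t),u(t))$, $x(0)=x_0\in G$, with controls $u(\cdot)\in\mathcal U=L^\infty_{\mathrm{loc}}([0,+\infty),U)$ (measurable, locally essentially bounded, $U$-valued) and Carathéodory solutions $x(\cdot;x_0,u(\cdot))$. $B_r$, $\bar B_r$ are the open and closed Euclidean balls of radius $r$ about $0$; an open domain is a nonempty open connected set; $\varphi:\Xi\to\mathbb R$ is proper if preimages of compact sets are compact, and positive definite if $\varphi(0)=0$ and $\varphi>0$ on $\Xi\setminus\{0\}$; $\partial^-\varphi(x;v)=\liminf_{\lambda\to0+,\,w\to v}\frac{\varphi(x+\lambda w)-\varphi(x)}{\lambda}$ is the lower Dini derivative. Assume: **(A) System.** (1) $U\subset\mathbb R^m$ is compact, $G,G_1\subseteq\mathbb R^n$ are open domains, $\bar G\subseteq G_1$, $0\in G$. (2) $f:G_1\times U\to\mathbb R^n$ is continuous. (3) Every solution in $G_1$ on an interval $[0,T)$, $0<T\le+\infty$, with $x_0\in G$ and $u(\cdot)\in\mathcal U$ stays in $G$. (4) For each $R>0$ there is $C_{1,R}>0$ with $\|f(x,u)-f(x',u)\|\le C_{1,R}\|x-x'\|$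 for $x,x'\in\bar B_R\cap\bar G$, $u\in U$. (5) There are a $C^1$ proper function $Y:G_1\to[0,+\infty)$ and $C_2>0$ with $\sup_{u\in U}\langle \mathrm DY(x),f(x,u)\rangle\le C_2Y(x)$ for all $x\in G_1$. **(B) Local control Lyapunov function.** (1) $\Omega\subseteq G$ is an open domain, $0\in\Omega$. (2) $V_{\mathrm{loc}}:\bar\Omega\to[0,+\infty)$ is continuous, proper and positive definite, and for some continuous positive definite $W_{\mathrm{loc}}:\Omega\to[0,+\infty)$ one has $\inf_{u\in U}\partial^-V_{\mathrm{loc}}(x;f(x,u))\le-W_{\mathrm{loc}}(x)$ for all $x\in\Omega$. (3) $V_{\mathrm{loc}}$ is locally Lipschitz in $\Omega$. (4) $c>0$ is such that $\{x\in\bar\Omega:V_{\mathrm{loc}}(x)<c\}$ is an open domain whose closure is $\Omega_c=\{x\in\bar\Omega:V_{\mathrm{loc}}(x)\le c\}$; $\Omega_c+B_{C_3}\subseteq\Omega$ for some $C_3>0$; and $\partial\Omega_c=l_c=\{x\in\bar\Omega:V_{\mathrm{loc}}(x)=c\}$ is a connected piecewise regular hypersurface (for which only the following is required: a closed set in which those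 points are dense near which it is the zero set of a $C^1$ function with nonvanishing gradient). (5) $\lim_{\varepsilon\to0+}\sup\{\|x\|:x\in\bar\Omega,\ V_{\mathrm{loc}}(x)\le\varepsilon\}=0$. **(C) Running cost.** (1) $g:\bar G\times U\to[0,+\infty)$ is continuous. (2) For each $R>0$ there is $C_{5,R}>0$ with $|g(x,u)-g(x',u)|\le C_{5,R}\|x-x'\|$ for $x,x'\in\bar B_R\cap\bar G$, $u\in U$. (3) $g(x,u)>0$ for $x\in G\setminus\{0\}$, $u\in U$. (4) $\inf\{g(x,u):x\in G\setminus\operatorname{int}\Omega_c,\ u\in U\}>0$. **(D) Convexity.** For every $x\in\bar G$ the set $\{(f(x,u),y)\in\mathbb R^n\times\mathbb R:u\in U,\ y\ge g(x,u)\}$ is convex. Let $\mathcal D_0$ be the set of all $x_0\in G$ for which some $u(\cdot)\in\mathcal U$ gives $\lim_{t\to+\infty}\|x(t;x_0,u(\cdot))\|=0$, and let $T_{\Omega_c}(x_0,u(\cdot))=\inf\{T\ge0:x(T;x_0,u(\cdot))\in\Omega_c\}$, with $\inf\emptyset=+\infty$. Consider the exit-time problem $$V(x_0)=\inf_{u(\cdot)\in\mathcal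 U:\ T_{\Omega_c}(x_0,u(\cdot))<+\infty}\Big\{\int_0^{T_{\Omega_c}(x_0,u(\cdot))}g(x(t;x_0,u(\cdot)),u(t))\,dt+c\Big\}\qquad(\mathrm P)$$ and its free-terminal-time form $$\inf_{u(\cdot)\in\mathcal U,\ T\in[0,+\infty):\ x(T;x_0,u(\cdot))\in\Omega_c}\Big\{\int_0^Tg(x(t;x_0,u(\cdot)),u(t))\,dt+c\Big\}.\qquad(\mathrm P')$$ **Theorem.** Under (A)–(D), for every $x_0\in\mathcal D_0\setminus\Omega_c$ the infima in $(\mathrm P)$ and $(\mathrm P')$ are finite and equal, and both are attained: there exists an optimal control $u^*(\cdot)\in\mathcal U$ for $(\mathrm P)$, and there exists an optimal pair $(u(\cdot),T)$ for $(\mathrm P')$. Moreover, a control $u(\cdot)$ is optimal for $(\mathrm P)$ if and only if $(u(\cdot),T)$ is optimal for $(\mathrm P')$ for some $T\in[0,+\infty)$. -/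

import Mathlib

open MeasureTheory Filter Topology Set
open scoped ENNReal Pointwise

noncomputable section

namespace ExitTime

/-! ### General notions -/

/-- The restriction of `φ` to `S` is proper: preimages (in `S`) of compact sets of reals are
compact. -/
def IsProperOn {n : ℕ} (φ : EuclideanSpace ℝ (Fin n) → ℝ)
    (S : Set (EuclideanSpace ℝ (Fin n))) : Prop :=
  ∀ M : Set ℝ, IsCompact M → IsCompact (S ∩ φ ⁻¹' M)

/-- The restriction of `φ` to `S` (a set containing the origin) is positive definite. -/
def IsPosDefOn {n : ℕ} (φ : EuclideanSpace ℝ (Fin n) → ℝ)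
    (S : Set (EuclideanSpace ℝ (Fin n))) : Prop :=
  φ 0 = 0 ∧ ∀ x ∈ S, x ≠ 0 → 0 < φ x

/-- An open domain: an open connected (nonempty) set. -/
def IsOpenDomain {n : ℕ} (S : Set (EuclideanSpace ℝ (Fin n))) : Prop :=
  IsOpen S ∧ IsConnected S

/-- The lower Dini derivative (directional subderivate) of `φ` at `x` in the direction `v`,
`liminf (φ (x + r w) - φ x) / r` as `r → 0+` and `w → v`, with values in `[-∞, +∞]`. -/
def lowerDini {n : ℕ} (φ : EuclideanSpace ℝ (Fin n) → ℝ)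
    (x v : EuclideanSpace ℝ (Fin n)) : EReal :=
  liminf (fun p : ℝ × EuclideanSpace ℝ (Fin n) =>
    (((φ (x + p.1 • p.2) - φ x) / p.1 : ℝ) : EReal)) (𝓝[>] (0 : ℝ) ×ˢ 𝓝 v)

/-- `S` is a regular hypersurface near its point `x`: in a neighbourhood of `x` it is the zero
set of a continuously differentiable function with nonvanishing derivative. -/
def IsRegularPoint {n : ℕ} (S : Set (EuclideanSpace ℝ (Fin n)))
    (x : EuclideanSpace ℝ (Fin n)) : Prop :=
  x ∈ S ∧ ∃ W : Set (EuclideanSpace ℝ (Fin n)), IsOpen W ∧ x ∈ W ∧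
    ∃ φ : EuclideanSpace ℝ (Fin n) → ℝ, ContDiffOn ℝ 1 φ W ∧
      (∀ y ∈ W, fderiv ℝ φ y ≠ 0) ∧ S ∩ W = {y ∈ W | φ y = 0}

/-- A piecewise regular hypersurface: a closed set in which the points near which it is a regular
hypersurface are dense (so edges, corners and conical points between the regular pieces are
allowed). -/
def IsPiecewiseRegularHypersurface {n : ℕ} (S : Set (EuclideanSpace ℝ (Fin n))) : Prop :=
  IsClosed S ∧ S ⊆ closure {x | IsRegularPoint S x}

/-! ### Controls and trajectories -/

/-- The class of control functions: locally essentially bounded (Lebesgue measurable) functions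
on `[0, ∞)` with values in `U`.  Values at negative times are irrelevant. -/
def IsControl {m : ℕ} (U : Set (EuclideanSpace ℝ (Fin m)))
    (u : ℝ → EuclideanSpace ℝ (Fin m)) : Prop :=
  (∀ t, 0 ≤ t → u t ∈ U) ∧ ∀ T : ℝ, MemLp u ∞ (volume.restrict (Icc 0 T))

/-- `x` is, on the time interval `I` (which is `[0, T]`, `[0, T)` or `[0, ∞)` below), a
Carathéodory solution with values in `G₁` of `x' = f (x, u)`, `x 0 = x₀`: it satisfies the
integral equation. -/
def IsTrajectory {n m : ℕ} (G₁ : Set (EuclideanSpace ℝ (Fin n)))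
    (f : EuclideanSpace ℝ (Fin n) → EuclideanSpace ℝ (Fin m) → EuclideanSpace ℝ (Fin n))
    (u : ℝ → EuclideanSpace ℝ (Fin m)) (x₀ : EuclideanSpace ℝ (Fin n)) (I : Set ℝ)
    (x : ℝ → EuclideanSpace ℝ (Fin n)) : Prop :=
  ∀ t ∈ I, x t ∈ G₁ ∧ IntervalIntegrable (fun s => f (x s) (u s)) volume 0 t ∧
    x t = x₀ + ∫ s in (0 : ℝ)..t, f (x s) (u s)

/-- The global region of asymptotic null-controllability. -/
def nullControllable {n m : ℕ} (U : Set (EuclideanSpace ℝ (Fin m)))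
    (G G₁ : Set (EuclideanSpace ℝ (Fin n)))
    (f : EuclideanSpace ℝ (Fin n) → EuclideanSpace ℝ (Fin m) → EuclideanSpace ℝ (Fin n)) :
    Set (EuclideanSpace ℝ (Fin n)) :=
  {x₀ | x₀ ∈ G ∧ ∃ u, IsControl U u ∧ ∃ x, IsTrajectory G₁ f u x₀ (Ici 0) x ∧
    Tendsto (fun t => ‖x t‖) atTop (𝓝 0)}

/-! ### Standing assumptions -/

/-- The assumptions on the control system. -/
structure SystemAssumption {n m : ℕ} (U : Set (EuclideanSpace ℝ (Fin m)))
    (G G₁ : Set (EuclideanSpace ℝ (Fin n)))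
    (f : EuclideanSpace ℝ (Fin n) → EuclideanSpace ℝ (Fin m) → EuclideanSpace ℝ (Fin n)) :
    Prop where
  isCompact_U : IsCompact U
  domain_G : IsOpenDomain G
  domain_G₁ : IsOpenDomain G₁
  closure_subset : closure G ⊆ G₁
  zero_mem : (0 : EuclideanSpace ℝ (Fin n)) ∈ G
  continuousOn_f : ContinuousOn (Function.uncurry f) (G₁ ×ˢ U)
  /-- Strong invariance of `G`.  The case of the interval `[0, ∞)` follows from that of all
  intervals `[0, T)`; since `G` is open, `x t ∈ G` excludes `x t ∈ frontier G`. -/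
  invariant : ∀ u, IsControl U u → ∀ x₀ ∈ G, ∀ T : ℝ, 0 < T → ∀ x,
    IsTrajectory G₁ f u x₀ (Ico 0 T) x → ∀ t ∈ Ico (0 : ℝ) T, x t ∈ G
  lipschitz_f : ∀ R : ℝ, 0 < R → ∃ C : ℝ, 0 < C ∧
    ∀ x ∈ Metric.closedBall 0 R ∩ closure G, ∀ x' ∈ Metric.closedBall 0 R ∩ closure G,
      ∀ u ∈ U, ‖f x u - f x' u‖ ≤ C * ‖x - x'‖
  growth : ∃ Y : EuclideanSpace ℝ (Fin n) → ℝ, ContDiffOn ℝ 1 Y G₁ ∧ (∀ x ∈ G₁, 0 ≤ Y x) ∧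
    IsProperOn Y G₁ ∧ ∃ C : ℝ, 0 < C ∧ ∀ x ∈ G₁, ∀ u ∈ U, fderiv ℝ Y x (f x u) ≤ C * Y x

/-- The sublevel set `Ω_c = {x ∈ closure Ω | V x ≤ c}`. -/
def sublevel {n : ℕ} (Ω : Set (EuclideanSpace ℝ (Fin n))) (V : EuclideanSpace ℝ (Fin n) → ℝ)
    (c : ℝ) : Set (EuclideanSpace ℝ (Fin n)) :=
  {x | x ∈ closure Ω ∧ V x ≤ c}

/-- The level set `l_c = {x ∈ closure Ω | V x = c}`. -/
def level {n : ℕ} (Ω : Set (EuclideanSpace ℝ (Fin n))) (V : EuclideanSpace ℝ (Fin n) → ℝ)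
    (c : ℝ) : Set (EuclideanSpace ℝ (Fin n)) :=
  {x | x ∈ closure Ω ∧ V x = c}

/-- The assumptions on the local control Lyapunov function `V` (used on `closure Ω` only) and on
the level `c`. -/
structure LocalCLFAssumption {n m : ℕ} (U : Set (EuclideanSpace ℝ (Fin m)))
    (G : Set (EuclideanSpace ℝ (Fin n)))
    (f : EuclideanSpace ℝ (Fin n) → EuclideanSpace ℝ (Fin m) → EuclideanSpace ℝ (Fin n))
    (Ω : Set (EuclideanSpace ℝ (Fin n))) (V : EuclideanSpace ℝ (Fin n) → ℝ) (c : ℝ) :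
    Prop where
  subset_G : Ω ⊆ G
  domain_Ω : IsOpenDomain Ω
  zero_mem : (0 : EuclideanSpace ℝ (Fin n)) ∈ Ω
  continuousOn_V : ContinuousOn V (closure Ω)
  nonneg_V : ∀ x ∈ closure Ω, 0 ≤ V x
  proper_V : IsProperOn V (closure Ω)
  posDef_V : IsPosDefOn V (closure Ω)
  decrease : ∃ W : EuclideanSpace ℝ (Fin n) → ℝ, ContinuousOn W Ω ∧ IsPosDefOn W Ω ∧
    ∀ x ∈ Ω, ⨅ u ∈ U, lowerDini V x (f x u) ≤ ((-W x : ℝ) : EReal)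
  locallyLipschitz_V : LocallyLipschitzOn Ω V
  c_pos : 0 < c
  domain_strict : IsOpenDomain {x | x ∈ closure Ω ∧ V x < c}
  closure_strict : closure {x | x ∈ closure Ω ∧ V x < c} = sublevel Ω V c
  margin : ∃ C : ℝ, 0 < C ∧ sublevel Ω V c + Metric.ball 0 C ⊆ Ω
  frontier_sublevel : frontier (sublevel Ω V c) = level Ω V c
  connected_level : IsConnected (level Ω V c)
  hypersurface_level : IsPiecewiseRegularHypersurface (level Ω V c)
  shrink : Tendsto (fun ε : ℝ => sSup ((fun x => ‖x‖) '' {x | x ∈ closure Ω ∧ V x ≤ ε}))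
    (𝓝[>] 0) (𝓝 0)

/-- The assumptions on the running cost `g`; `K` is the target set.  The last one says that
the infimum of `g` over `(G \ interior K) × U` is positive. -/
structure CostAssumption {n m : ℕ} (U : Set (EuclideanSpace ℝ (Fin m)))
    (G : Set (EuclideanSpace ℝ (Fin n)))
    (g : EuclideanSpace ℝ (Fin n) → EuclideanSpace ℝ (Fin m) → ℝ)
    (K : Set (EuclideanSpace ℝ (Fin n))) : Prop where
  continuousOn_g : ContinuousOn (Function.uncurry g) (closure G ×ˢ U)
  nonneg_g : ∀ x ∈ closure G, ∀ u ∈ U, 0 ≤ g x u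
  lipschitz_g : ∀ R : ℝ, 0 < R → ∃ C : ℝ, 0 < C ∧
    ∀ x ∈ Metric.closedBall 0 R ∩ closure G, ∀ x' ∈ Metric.closedBall 0 R ∩ closure G,
      ∀ u ∈ U, |g x u - g x' u| ≤ C * ‖x - x'‖
  pos_g : ∀ x ∈ G, x ≠ 0 → ∀ u ∈ U, 0 < g x u
  inf_pos : ∃ C : ℝ, 0 < C ∧ ∀ x ∈ G \ interior K, ∀ u ∈ U, C ≤ g x u

/-- Convexity of the extended velocity sets. -/
def ConvexityAssumption {n m : ℕ} (U : Set (EuclideanSpace ℝ (Fin m)))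
    (G : Set (EuclideanSpace ℝ (Fin n)))
    (f : EuclideanSpace ℝ (Fin n) → EuclideanSpace ℝ (Fin m) → EuclideanSpace ℝ (Fin n))
    (g : EuclideanSpace ℝ (Fin n) → EuclideanSpace ℝ (Fin m) → ℝ) : Prop :=
  ∀ x ∈ closure G,
    Convex ℝ {p : EuclideanSpace ℝ (Fin n) × ℝ | ∃ u ∈ U, p.1 = f x u ∧ g x u ≤ p.2}

/-! ### The exit-time problem -/

/-- The minimum time of reaching `K` from `x₀` under the control `u` (`⊤` if `K` is never
reached). -/
def exitTime {n m : ℕ} (G₁ : Set (EuclideanSpace ℝ (Fin n)))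
    (f : EuclideanSpace ℝ (Fin n) → EuclideanSpace ℝ (Fin m) → EuclideanSpace ℝ (Fin n))
    (K : Set (EuclideanSpace ℝ (Fin n))) (x₀ : EuclideanSpace ℝ (Fin n))
    (u : ℝ → EuclideanSpace ℝ (Fin m)) : ℝ≥0∞ :=
  sInf {τ | ∃ T : ℝ, 0 ≤ T ∧ τ = ENNReal.ofReal T ∧
    ∃ x, IsTrajectory G₁ f u x₀ (Icc 0 T) x ∧ x T ∈ K}

/-- Running cost of the pair `(x, u)` over `[0, T]` plus the constant terminal cost `c`. -/
def cost {n m : ℕ} (g : EuclideanSpace ℝ (Fin n) → EuclideanSpace ℝ (Fin m) → ℝ) (c : ℝ)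
    (x : ℝ → EuclideanSpace ℝ (Fin n)) (u : ℝ → EuclideanSpace ℝ (Fin m)) (T : ℝ) : ℝ≥0∞ :=
  (∫⁻ t in Icc 0 T, ENNReal.ofReal (g (x t) (u t))) + ENNReal.ofReal c

/-- `J` is the cost of the control `u` in the problem with exit at the first time of reaching `K`;
in particular this time is finite. -/
def IsExitCost {n m : ℕ} (U : Set (EuclideanSpace ℝ (Fin m)))
    (G₁ : Set (EuclideanSpace ℝ (Fin n)))
    (f : EuclideanSpace ℝ (Fin n) → EuclideanSpace ℝ (Fin m) → EuclideanSpace ℝ (Fin n))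
    (g : EuclideanSpace ℝ (Fin n) → EuclideanSpace ℝ (Fin m) → ℝ) (c : ℝ)
    (K : Set (EuclideanSpace ℝ (Fin n))) (x₀ : EuclideanSpace ℝ (Fin n))
    (u : ℝ → EuclideanSpace ℝ (Fin m)) (J : ℝ≥0∞) : Prop :=
  IsControl U u ∧ exitTime G₁ f K x₀ u < ∞ ∧
    ∃ x, IsTrajectory G₁ f u x₀ (Icc 0 (exitTime G₁ f K x₀ u).toReal) x ∧
      J = cost g c x u (exitTime G₁ f K x₀ u).toReal

/-- `J` is the cost of the pair `(u, T)` in the problem with free terminal time `T` and terminal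
constraint `x T ∈ K`. -/
def IsFreeTimeCost {n m : ℕ} (U : Set (EuclideanSpace ℝ (Fin m)))
    (G₁ : Set (EuclideanSpace ℝ (Fin n)))
    (f : EuclideanSpace ℝ (Fin n) → EuclideanSpace ℝ (Fin m) → EuclideanSpace ℝ (Fin n))
    (g : EuclideanSpace ℝ (Fin n) → EuclideanSpace ℝ (Fin m) → ℝ) (c : ℝ)
    (K : Set (EuclideanSpace ℝ (Fin n))) (x₀ : EuclideanSpace ℝ (Fin n))
    (u : ℝ → EuclideanSpace ℝ (Fin m)) (T : ℝ) (J : ℝ≥0∞) : Prop :=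
  IsControl U u ∧ 0 ≤ T ∧ ∃ x, IsTrajectory G₁ f u x₀ (Icc 0 T) x ∧ x T ∈ K ∧ J = cost g c x u T

/-- The value function of the first-exit problem (`⊤` if `K` cannot be reached). -/
def exitValue {n m : ℕ} (U : Set (EuclideanSpace ℝ (Fin m)))
    (G₁ : Set (EuclideanSpace ℝ (Fin n)))
    (f : EuclideanSpace ℝ (Fin n) → EuclideanSpace ℝ (Fin m) → EuclideanSpace ℝ (Fin n))
    (g : EuclideanSpace ℝ (Fin n) → EuclideanSpace ℝ (Fin m) → ℝ) (c : ℝ)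
    (K : Set (EuclideanSpace ℝ (Fin n))) (x₀ : EuclideanSpace ℝ (Fin n)) : ℝ≥0∞ :=
  sInf {J | ∃ u, IsExitCost U G₁ f g c K x₀ u J}

/-- The value function of the free-terminal-time problem. -/
def freeTimeValue {n m : ℕ} (U : Set (EuclideanSpace ℝ (Fin m)))
    (G₁ : Set (EuclideanSpace ℝ (Fin n)))
    (f : EuclideanSpace ℝ (Fin n) → EuclideanSpace ℝ (Fin m) → EuclideanSpace ℝ (Fin n))
    (g : EuclideanSpace ℝ (Fin n) → EuclideanSpace ℝ (Fin m) → ℝ) (c : ℝ)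
    (K : Set (EuclideanSpace ℝ (Fin n))) (x₀ : EuclideanSpace ℝ (Fin n)) : ℝ≥0∞ :=
  sInf {J | ∃ u T, IsFreeTimeCost U G₁ f g c K x₀ u T J}

/-- `u` is an optimal control in the first-exit problem. -/
def IsOptimalControl {n m : ℕ} (U : Set (EuclideanSpace ℝ (Fin m)))
    (G₁ : Set (EuclideanSpace ℝ (Fin n)))
    (f : EuclideanSpace ℝ (Fin n) → EuclideanSpace ℝ (Fin m) → EuclideanSpace ℝ (Fin n))
    (g : EuclideanSpace ℝ (Fin n) → EuclideanSpace ℝ (Fin m) → ℝ) (c : ℝ)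
    (K : Set (EuclideanSpace ℝ (Fin n))) (x₀ : EuclideanSpace ℝ (Fin n))
    (u : ℝ → EuclideanSpace ℝ (Fin m)) : Prop :=
  IsExitCost U G₁ f g c K x₀ u (exitValue U G₁ f g c K x₀)

/-- `(u, T)` is an optimal pair in the free-terminal-time problem. -/
def IsOptimalPair {n m : ℕ} (U : Set (EuclideanSpace ℝ (Fin m)))
    (G₁ : Set (EuclideanSpace ℝ (Fin n)))
    (f : EuclideanSpace ℝ (Fin n) → EuclideanSpace ℝ (Fin m) → EuclideanSpace ℝ (Fin n))
    (g : EuclideanSpace ℝ (Fin n) → EuclideanSpace ℝ (Fin m) → ℝ) (c : ℝ)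
    (K : Set (EuclideanSpace ℝ (Fin n))) (x₀ : EuclideanSpace ℝ (Fin n))
    (u : ℝ → EuclideanSpace ℝ (Fin m)) (T : ℝ) : Prop :=
  IsFreeTimeCost U G₁ f g c K x₀ u T (freeTimeValue U G₁ f g c K x₀)

end ExitTime

end

namespace ExitTime

/-! ### Measurable selection of zeros -/

/-! The two problems agree because exit is only a stopping rule. The target `K` is closed and
trajectories are unique, so a trajectory that reaches `K` first does so exactly at `exitTime`; since
the running cost is nonnegative, cutting there cannot raise the cost (`IsFreeTimeCost.exists_exit`).
Hence the values and the optimal controls coincide, and it remains to see that the value is finite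
and that an optimal pair exists. Finiteness holds because `K` is a neighbourhood of the origin, so a
null-controlling trajectory enters it in finite time.

Existence is Filippov's direct method (`exists_isOptimalPair`). Stop a minimizing sequence at the
exit times. Outside the interior of `K` the running cost has a positive lower bound, so these times
are bounded; the growth function `Y` and Gronwall then confine all trajectories to one compact set.
The curves (state, accumulated cost) are therefore uniformly Lipschitz and have a limit `p`.
Wherever `p` is differentiable, its derivative is a limit of averages of velocities close to the
closed convex extended velocity set, hence lies in that set (`deriv_mem_of_tendsto`). Measurable
selection turns this into a control that generates the state component of `p` and whose running cost
is at most its cost component (`exists_control_of_deriv_mem`), so the infimum is attained. -/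

/-- The projection of the zero set of a nonnegative Carathéodory function over a compact set is
measurable. -/
theorem measurableSet_exists_zero {α X : Type*} [MeasurableSpace α] [PseudoMetricSpace X]
    {S : Set X} (hS : IsCompact S) {h : α → X → ℝ} (hm : ∀ u ∈ S, Measurable fun a => h a u)
    (hc : ∀ a, ContinuousOn (h a) S) (h0 : ∀ a, ∀ u ∈ S, 0 ≤ h a u) :
    MeasurableSet {a | ∃ u ∈ S, h a u = 0} := by
  obtain ⟨D, hDS, hDc, hD⟩ : ∃ D ⊆ S, D.Countable ∧ S ⊆ closure D :=
    hS.isSeparable.exists_countable_dense_subset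
  -- By compactness a zero exists iff `S` is nonempty and the infimum of `h a` is zero; by
  -- continuity that infimum can be tested on the countable dense set `D`.
  have key : {a | ∃ u ∈ S, h a u = 0} =
      ⋂ n : ℕ, ⋃ d ∈ D, {a | h a d < 1 / ((n : ℝ) + 1)} := by
    ext a
    simp only [mem_ofPred_eq, mem_iInter, mem_iUnion, exists_prop]
    constructor
    · rintro ⟨u, hu, hz⟩ n
      have hn : (0 : ℝ) < 1 / ((n : ℝ) + 1) := by positivity
      have h1 : ∀ᶠ d in 𝓝[D] u, h a d < 1 / ((n : ℝ) + 1) :=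
        (((hc a) u hu).mono hDS).eventually (gt_mem_nhds (by rwa [hz]))
      have : (𝓝[D] u).NeBot := mem_closure_iff_nhdsWithin_neBot.1 (hD hu)
      obtain ⟨d, hd, hdD⟩ := (h1.and self_mem_nhdsWithin).exists
      exact ⟨d, hdD, hd⟩
    · intro H
      obtain ⟨d, hd, -⟩ := H 0
      obtain ⟨u, hu, hmin⟩ := hS.exists_isMinOn ⟨d, hDS hd⟩ (hc a)
      refine ⟨u, hu, le_antisymm (le_of_forall_pos_lt_add fun ε hε => ?_) (h0 a u hu)⟩
      obtain ⟨n, hn⟩ := exists_nat_one_div_lt hε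
      obtain ⟨d, hd, hlt⟩ := H n
      have : h a u ≤ h a d := hmin (hDS hd)
      linarith
  rw [key]
  exact MeasurableSet.iInter fun n => MeasurableSet.biUnion hDc fun d hd =>
    measurableSet_lt (hm d (hDS hd)) measurable_const

/-- The minimum of a continuous function over the zero sets of a Carathéodory function is
measurable. -/
theorem exists_measurable_min_zero {α X : Type*} [MeasurableSpace α] [PseudoMetricSpace X]
    {S : Set X} (hS : IsCompact S) {h : α → X → ℝ} (hm : ∀ u ∈ S, Measurable fun a => h a u)
    (hc : ∀ a, ContinuousOn (h a) S) (h0 : ∀ a, ∀ u ∈ S, 0 ≤ h a u)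
    (hz : ∀ a, ∃ u ∈ S, h a u = 0) {φ : X → ℝ} (hφ : Continuous φ) :
    ∃ c : α → ℝ, Measurable c ∧ ∀ a, ∃ u ∈ S, h a u = 0 ∧ φ u = c a := by
  have hmin : ∀ a, ∃ u ∈ S, h a u = 0 ∧ ∀ w ∈ S, h a w = 0 → φ u ≤ φ w := by
    intro a
    have hK : IsCompact (S ∩ h a ⁻¹' {0}) := by
      obtain ⟨Z, hZ, hZe⟩ := continuousOn_iff_isClosed.1 (hc a) {0} isClosed_singleton
      rw [inter_comm, hZe, inter_comm]
      exact hS.inter_right hZ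
    obtain ⟨w, hw, hw0⟩ := hz a
    obtain ⟨u, hu, hle⟩ := hK.exists_isMinOn ⟨w, hw, hw0⟩ hφ.continuousOn
    exact ⟨u, hu.1, hu.2, fun w hw hw0 => hle ⟨hw, hw0⟩⟩
  choose s hsS hs0 hsmin using hmin
  -- The minimum is at most `r` iff `h a` has a zero in the compact set `S ∩ {φ ≤ r}`, so the
  -- previous lemma applies.
  refine ⟨fun a => φ (s a), measurable_of_Iic fun r => ?_, fun a => ⟨s a, hsS a, hs0 a, rfl⟩⟩
  have hcl : IsClosed {u | φ u ≤ r} := isClosed_le hφ continuous_const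
  convert measurableSet_exists_zero (hS.inter_right hcl) (fun u hu => hm u hu.1)
    (fun a => (hc a).mono inter_subset_left) (fun a u hu => h0 a u hu.1) using 1
  ext a
  simp only [mem_preimage, mem_Iic, mem_ofPred_eq, mem_inter_iff]
  exact ⟨fun H => ⟨s a, ⟨hsS a, H⟩, hs0 a⟩, fun ⟨u, hu, hu0⟩ => (hsmin a u hu.1 hu0).trans hu.2⟩

/-- A nonnegative Carathéodory function with zeros in a compact set has a measurable selection of
zeros. -/
theorem exists_measurable_zero {α : Type*} [MeasurableSpace α] {m : ℕ}
    {S : Set (EuclideanSpace ℝ (Fin m))} (hS : IsCompact S)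
    {h : α → EuclideanSpace ℝ (Fin m) → ℝ} (hm : ∀ u ∈ S, Measurable fun a => h a u)
    (hc : ∀ a, ContinuousOn (h a) S) (h0 : ∀ a, ∀ u ∈ S, 0 ≤ h a u)
    (hz : ∀ a, ∃ u ∈ S, h a u = 0) :
    ∃ σ : α → EuclideanSpace ℝ (Fin m), Measurable σ ∧ ∀ a, σ a ∈ S ∧ h a (σ a) = 0 := by
  -- Coordinates are fixed one at a time, each as a measurable minimum. The penalty `∑ |u i - c i
  -- a|` added to `h` restricts the zeros to those with the coordinates already chosen. Once all are
  -- fixed the zero is determined, hence measurable in `a`.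
  have key : ∀ s : Finset (Fin m), ∃ c : Fin m → α → ℝ, (∀ i, Measurable (c i)) ∧
      ∀ a, ∃ u ∈ S, h a u = 0 ∧ ∀ i ∈ s, u i = c i a := by
    intro s
    induction s using Finset.induction_on with
    | empty =>
      exact ⟨fun _ _ => 0, fun _ => measurable_const, fun a => by simpa using hz a⟩
    | insert j s hj ih =>
      obtain ⟨c, hcm, hcz⟩ := ih
      have hcoord : ∀ i : Fin m, Continuous fun u : EuclideanSpace ℝ (Fin m) => u i :=
        fun i => by fun_prop
      have hnn : ∀ a (u : EuclideanSpace ℝ (Fin m)), 0 ≤ ∑ i ∈ s, |u i - c i a| :=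
        fun a u => Finset.sum_nonneg fun i _ => abs_nonneg _
      obtain ⟨d, hdm, hdz⟩ := exists_measurable_min_zero hS
        (h := fun a u => h a u + ∑ i ∈ s, |u i - c i a|)
        (fun u hu => (hm u hu).add (Finset.measurable_sum _ fun i _ =>
          (measurable_const.sub (hcm i)).abs))
        (fun a => (hc a).add (Continuous.continuousOn (by fun_prop)))
        (fun a u hu => add_nonneg (h0 a u hu) (hnn a u))
        (fun a => by
          obtain ⟨u, hu, hu0, hui⟩ := hcz a
          refine ⟨u, hu, ?_⟩
          rw [hu0, zero_add]
          exact Finset.sum_eq_zero fun i hi => by rw [hui i hi]; simp)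
        (hcoord j)
      refine ⟨Function.update c j d, fun i => ?_, fun a => ?_⟩
      · by_cases hij : i = j
        · subst hij; simpa using hdm
        · simpa [Function.update_of_ne hij] using hcm i
      · obtain ⟨u, hu, hu0, huj⟩ := hdz a
        have h1 := h0 a u hu
        have h2 := hnn a u
        have h3 : ∑ i ∈ s, |u i - c i a| = 0 := by linarith
        refine ⟨u, hu, by linarith, fun i hi => ?_⟩
        by_cases hij : i = j
        · subst hij; simpa using huj
        · rw [Function.update_of_ne hij]
          have hi' : i ∈ s := (Finset.mem_insert.1 hi).resolve_left hij
          have := (Finset.sum_eq_zero_iff_of_nonneg fun i _ => abs_nonneg _).1 h3 i hi'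
          exact sub_eq_zero.1 (abs_eq_zero.1 this)
  obtain ⟨c, hcm, hcz⟩ := key Finset.univ
  refine ⟨fun a => WithLp.toLp 2 fun i => c i a, ?_, fun a => ?_⟩
  · exact (WithLp.measurable_toLp 2 _).comp (measurable_pi_lambda _ hcm)
  · obtain ⟨u, hu, hu0, hui⟩ := hcz a
    have : WithLp.toLp 2 (fun i => c i a) = u := by
      ext i; simp [hui i (Finset.mem_univ i)]
    simpa only [this] using ⟨hu, hu0⟩

/-- Almost-everywhere version of `exists_measurable_zero`. -/
theorem exists_measurable_ae_zero {α : Type*} [MeasurableSpace α] {μ : Measure α} {m : ℕ}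
    {S : Set (EuclideanSpace ℝ (Fin m))} (hS : IsCompact S) (hne : S.Nonempty)
    {h : α → EuclideanSpace ℝ (Fin m) → ℝ} (hm : ∀ u ∈ S, Measurable fun a => h a u)
    (hc : ∀ a, ContinuousOn (h a) S) (h0 : ∀ a, ∀ u ∈ S, 0 ≤ h a u)
    (hz : ∀ᵐ a ∂μ, ∃ u ∈ S, h a u = 0) :
    ∃ σ : α → EuclideanSpace ℝ (Fin m), Measurable σ ∧ (∀ a, σ a ∈ S) ∧
      ∀ᵐ a ∂μ, h a (σ a) = 0 := by
  classical
  set N : Set α := {a | ∃ u ∈ S, h a u = 0} with hN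
  have hNm : MeasurableSet N := measurableSet_exists_zero hS hm hc h0
  -- Off the measurable set `N` the function is replaced by zero, so that zeros exist everywhere.
  obtain ⟨σ, hσ, hσz⟩ := exists_measurable_zero hS (h := fun a u => if a ∈ N then h a u else 0)
    (fun u hu => Measurable.ite hNm (hm u hu) measurable_const)
    (fun a => by by_cases ha : a ∈ N <;> simp [ha, hc a, continuousOn_const])
    (fun a u hu => by by_cases ha : a ∈ N <;> simp [ha, h0 a u hu])
    (fun a => by
      by_cases ha : a ∈ N
      · obtain ⟨u, hu, hu0⟩ := id ha
        exact ⟨u, hu, by rw [if_pos ha, hu0]⟩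
      · obtain ⟨u, hu⟩ := hne
        exact ⟨u, hu, if_neg ha⟩)
  refine ⟨σ, hσ, fun a => (hσz a).1, ?_⟩
  filter_upwards [hz] with a ha
  have := (hσz a).2
  rwa [if_pos (show a ∈ N from ha)] at this

/-! ### Averages and derivatives -/

/-- Averages stay in closed convex sets. This replaces pointwise differentiation of trajectories,
which fails on a null set. -/
theorem inv_smul_intervalIntegral_mem {X : Type*} [NormedAddCommGroup X] [NormedSpace ℝ X]
    [CompleteSpace X] {Q : Set X} (hQ : Convex ℝ Q) (hQc : IsClosed Q) {a b : ℝ} (hab : a < b)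
    {v : ℝ → X} (hint : IntervalIntegrable v volume a b) (hv : ∀ s ∈ Ioc a b, v s ∈ Q) :
    (b - a)⁻¹ • ∫ s in a..b, v s ∈ Q := by
  have := hQ.set_average_mem (μ := volume) (t := Ioc a b) (f := v) hQc (by simp [hab]) (by simp)
    ((ae_restrict_iff' measurableSet_Ioc).2 (ae_of_all _ hv))
    ((intervalIntegrable_iff_integrableOn_Ioc_of_le hab.le).1 hint)
  rw [← uIoc_of_le hab.le, interval_average_eq] at this
  exact this

/-- If the velocities of approximating curves are eventually close to a closed convex set, then
the derivative of their pointwise limit belongs to that set. -/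
theorem deriv_mem_of_tendsto {ι X : Type*} [NormedAddCommGroup X] [NormedSpace ℝ X]
    [CompleteSpace X] {l : Filter ι} [l.NeBot] {P v : ι → ℝ → X} {p : ℝ → X} {p' : X} {t : ℝ}
    {Q : Set X} (hQ : Convex ℝ Q) (hQc : IsClosed Q)
    (hlim : ∀ s, Tendsto (fun k => P k s) l (𝓝 (p s))) (hp : HasDerivAt p p' t)
    (hP : ∀ k s, IntervalIntegrable (v k) volume t s ∧ P k s - P k t = ∫ r in t..s, v k r)
    (hv : ∀ ε > 0, ∃ δ > 0, ∀ s ∈ Ioo t (t + δ), ∀ᶠ k in l, ∀ r ∈ Ioc t s,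
      v k r ∈ Metric.cthickening ε Q) : p' ∈ Q := by
  have hslope : Tendsto (fun s => (s - t)⁻¹ • (p s - p t)) (𝓝[>] t) (𝓝 p') := by
    have := (hasDerivAt_iff_tendsto_slope.1 hp).mono_left
      (nhdsWithin_mono t (show Ioi t ⊆ {t}ᶜ from fun s hs => (mem_Ioi.1 hs).ne'))
    simpa [slope_fun_def] using this
  -- Two limits in order: for fixed `s` the index `k` goes to its limit, which puts the difference
  -- quotient of `p` in the thickening; then `s` decreases to `t`.
  have key : ∀ ε > 0, p' ∈ Metric.cthickening ε Q := by
    intro ε hε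
    obtain ⟨δ, hδ, H⟩ := hv ε hε
    refine Metric.isClosed_cthickening.mem_of_tendsto hslope ?_
    filter_upwards [Ioo_mem_nhdsGT (show t < t + δ by linarith)] with s hs
    refine Metric.isClosed_cthickening.mem_of_tendsto
      (((hlim s).sub (hlim t)).const_smul (s - t)⁻¹) ?_
    filter_upwards [H s hs] with k hk
    rw [(hP k s).2]
    exact inv_smul_intervalIntegral_mem (hQ.cthickening ε) Metric.isClosed_cthickening hs.1
      (hP k s).1 hk
  have : p' ∈ closure Q := by
    rw [Metric.closure_eq_iInter_cthickening]
    exact mem_iInter₂.2 key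
  rwa [hQc.closure_eq] at this

/-- Fundamental theorem of calculus for Lipschitz curves. -/
theorem integral_deriv_of_lipschitzWith {X : Type*} [NormedAddCommGroup X] [NormedSpace ℝ X]
    [FiniteDimensional ℝ X] {L : NNReal} {p : ℝ → X} (hp : LipschitzWith L p) (a b : ℝ) :
    IntervalIntegrable (deriv p) volume a b ∧ ∫ t in a..b, deriv p t = p b - p a := by
  have : CompleteSpace X := FiniteDimensional.complete ℝ X
  borelize X
  have hbd : ∀ t, ‖deriv p t‖ ≤ L := fun t => norm_deriv_le_of_lipschitz hp
  have hint : ∀ a b, IntervalIntegrable (deriv p) volume a b := fun a b =>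
    (intervalIntegrable_const (c := (L : ℝ))).mono_fun
      (stronglyMeasurable_deriv p).aestronglyMeasurable
      (ae_of_all _ fun t => by simpa using hbd t)
  refine ⟨hint a b, ?_⟩
  have hI : LipschitzWith L fun t => ∫ s in a..t, deriv p s := by
    refine LipschitzWith.of_dist_le_mul fun s t => ?_
    rw [dist_eq_norm, intervalIntegral.integral_interval_sub_left (hint _ _) (hint _ _)]
    simpa [Real.dist_eq] using
      intervalIntegral.norm_integral_le_of_norm_le_const (a := t) (b := s) fun x _ => hbd x
  -- The curve minus the primitive of its derivative is Lipschitz with derivative zero almost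
  -- everywhere, hence constant.
  have hac := ((hp.sub hI).lipschitzOnWith (s := uIcc a b)).absolutelyContinuousOnInterval
  have hconst := hac.const_of_ae_hasDerivAt_zero ?_
  · obtain ⟨C, hC⟩ := hconst
    have h1 := hC a left_mem_uIcc
    have h2 := hC b right_mem_uIcc
    simp only [intervalIntegral.integral_same, sub_zero] at h1 h2
    rw [← h1, sub_eq_iff_eq_add] at h2
    rw [h2, add_sub_cancel_left]
  · have hD := IntervalIntegrable.ae_hasDerivAt_integral (hint a b)
    filter_upwards [hD, hp.ae_differentiableAt (μ := volume)] with t h1 h2 ht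
    have h3 := h2.hasDerivAt.sub (h1 ht a left_mem_uIcc)
    rw [sub_self] at h3
    exact h3

variable {n m : ℕ} {U : Set (EuclideanSpace ℝ (Fin m))} {G G₁ K : Set (EuclideanSpace ℝ (Fin n))}
  {f : EuclideanSpace ℝ (Fin n) → EuclideanSpace ℝ (Fin m) → EuclideanSpace ℝ (Fin n)}
  {g : EuclideanSpace ℝ (Fin n) → EuclideanSpace ℝ (Fin m) → ℝ} {c : ℝ}
  {u : ℝ → EuclideanSpace ℝ (Fin m)} {x₀ : EuclideanSpace ℝ (Fin n)}
  {x z : ℝ → EuclideanSpace ℝ (Fin n)} {T : ℝ}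

/-! ### Trajectories -/

theorem IsTrajectory.mono {I J : Set ℝ} (hx : IsTrajectory G₁ f u x₀ I x) (h : J ⊆ I) :
    IsTrajectory G₁ f u x₀ J x := fun t ht => hx t (h ht)

theorem IsTrajectory.apply_zero {I : Set ℝ} (hx : IsTrajectory G₁ f u x₀ I x)
    (h : (0 : ℝ) ∈ I) : x 0 = x₀ := by
  simpa using (hx 0 h).2.2

theorem IsTrajectory.intervalIntegrable {I : Set ℝ} (hx : IsTrajectory G₁ f u x₀ I x) {s t : ℝ}
    (hs : s ∈ I) (ht : t ∈ I) : IntervalIntegrable (fun r => f (x r) (u r)) volume s t :=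
  (hx s hs).2.1.symm.trans (hx t ht).2.1

theorem IsTrajectory.sub_eq {I : Set ℝ} (hx : IsTrajectory G₁ f u x₀ I x) {s t : ℝ}
    (hs : s ∈ I) (ht : t ∈ I) : x t - x s = ∫ r in s..t, f (x r) (u r) := by
  rw [(hx t ht).2.2, (hx s hs).2.2, add_sub_add_left_eq_sub,
    intervalIntegral.integral_interval_sub_left (hx t ht).2.1 (hx s hs).2.1]

theorem IsTrajectory.continuousOn (hT : 0 ≤ T) (hx : IsTrajectory G₁ f u x₀ (Icc 0 T) x) :
    ContinuousOn x (Icc 0 T) := by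
  have h1 := (hx T ⟨hT, le_rfl⟩).2.1
  have h2 : ContinuousOn (fun t => ∫ s in (0 : ℝ)..t, f (x s) (u s)) (uIcc 0 T) :=
    intervalIntegral.continuousOn_primitive_interval' h1 left_mem_uIcc
  rw [uIcc_of_le hT] at h2
  exact (continuousOn_const.add h2).congr fun t ht => (hx t ht).2.2

theorem IsTrajectory.tendsto_nhdsGT (hx : IsTrajectory G₁ f u x₀ (Icc 0 T) x) {t : ℝ}
    (ht : t ∈ Ico 0 T) : Tendsto x (𝓝[>] t) (𝓝[G₁] (x t)) := by
  have hT : 0 ≤ T := ht.1.trans ht.2.le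
  have hmem : Icc 0 T ∈ 𝓝[>] t :=
    mem_of_superset (Ioc_mem_nhdsGT ht.2) fun s hs => ⟨ht.1.trans hs.1.le, hs.2⟩
  refine tendsto_nhdsWithin_iff.2 ⟨?_, mem_of_superset hmem fun s hs => (hx s hs).1⟩
  exact (hx.continuousOn hT t ⟨ht.1, ht.2.le⟩).mono_left (nhdsWithin_le_iff.2 hmem)

/-- Invariance covers only `[0, T)`; the endpoint follows by continuity, at the price of the
closure. -/
theorem IsTrajectory.mem_closure (hsys : SystemAssumption U G G₁ f) (hu : IsControl U u)
    (hx₀ : x₀ ∈ G) (hx : IsTrajectory G₁ f u x₀ (Icc 0 T) x) {t : ℝ} (ht : t ∈ Icc 0 T) :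
    x t ∈ closure G := by
  have hT : 0 ≤ T := ht.1.trans ht.2
  rcases hT.eq_or_lt with rfl | hT'
  · obtain rfl : t = 0 := le_antisymm ht.2 ht.1
    rw [hx.apply_zero ht]
    exact subset_closure hx₀
  · have hG := hsys.invariant u hu x₀ hx₀ T hT' x (hx.mono Ico_subset_Icc_self)
    have h1 : t ∈ closure (Ico 0 T) := by rwa [closure_Ico hT'.ne]
    have h2 := ((hx.continuousOn hT t ht).mono Ico_subset_Icc_self).mem_closure_image h1
    exact closure_mono (image_subset_iff.2 hG) h2

/-! ### Growth estimate, confinement to compact sets, uniqueness -/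

theorem eventually_forall_mem_Ioc {P : ℝ → Prop} {t : ℝ} (h : ∀ᶠ s in 𝓝[>] t, P s) :
    ∀ᶠ s in 𝓝[>] t, ∀ r ∈ Ioc t s, P r := by
  obtain ⟨b, hb, hP⟩ := mem_nhdsGT_iff_exists_Ioo_subset.1 h
  filter_upwards [Ioo_mem_nhdsGT hb] with s hs r hr
  exact hP ⟨hr.1, hr.2.trans_lt hs.2⟩

/-- Compactness of `U` makes continuity in the state uniform in the control, so a merely measurable
control can be inserted. -/
theorem eventually_norm_sub_lt {X : Type*} [NormedAddCommGroup X]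
    {S : Set (EuclideanSpace ℝ (Fin n))}
    {F : EuclideanSpace ℝ (Fin n) → EuclideanSpace ℝ (Fin m) → X}
    (hU : IsCompact U) (hF : ContinuousOn (Function.uncurry F) (S ×ˢ U))
    {y : EuclideanSpace ℝ (Fin n)} (hy : y ∈ S) {ε : ℝ} (hε : 0 < ε) :
    ∀ᶠ y' in 𝓝[S] y, ∀ w ∈ U, ‖F y' w - F y w‖ < ε := by
  obtain ⟨v, hv, H⟩ := hU.mem_uniformity_of_prod hF hy (Metric.dist_mem_uniformity hε)
  filter_upwards [hv] with y' hy' w hw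
  simpa [dist_eq_norm] using H y' hy' w hw

/-- Gronwall in Dini form: the bound on `fderiv ℝ Y x (f x w)` is uniform in `w`, so it survives
averaging over a short interval and controls the right difference quotients of `Y` along the
trajectory at every time. -/
theorem IsTrajectory.growth_bound (hsys : SystemAssumption U G G₁ f) (hu : IsControl U u)
    (hx : IsTrajectory G₁ f u x₀ (Icc 0 T) x)
    {Y : EuclideanSpace ℝ (Fin n) → ℝ} (hY : ContDiffOn ℝ 1 Y G₁) {C : ℝ}
    (hYf : ∀ x ∈ G₁, ∀ w ∈ U, fderiv ℝ Y x (f x w) ≤ C * Y x) {t : ℝ} (ht : t ∈ Icc 0 T) :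
    Y (x t) ≤ Y x₀ * Real.exp (C * t) := by
  have hT : 0 ≤ T := ht.1.trans ht.2
  have h0 : x 0 = x₀ := hx.apply_zero ⟨le_rfl, hT⟩
  have hcont : ContinuousOn (fun s => Y (x s)) (Icc 0 T) :=
    hY.continuousOn.comp (hx.continuousOn hT) fun s hs => (hx s hs).1
  have := le_gronwallBound_of_liminf_deriv_right_le (f' := fun s => C * Y (x s)) (δ := Y x₀)
    (K := C) (ε := 0) hcont ?_ (by rw [h0]) (by simp) t ht
  · simpa [gronwallBound_ε0] using this
  intro t ht r hr
  refine Eventually.frequently ?_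
  have hxt : x t ∈ G₁ := (hx t ⟨ht.1, ht.2.le⟩).1
  set D := fderiv ℝ Y (x t) with hD
  have hdiff : HasFDerivAt Y D (x t) :=
    ((hY.differentiableOn one_ne_zero).differentiableAt
      (hsys.domain_G₁.1.mem_nhds hxt)).hasFDerivAt
  obtain ⟨B, hB⟩ : ∃ B, ∀ w ∈ U, ‖f (x t) w‖ ≤ B :=
    hsys.isCompact_U.exists_bound_of_continuousOn
      (hsys.continuousOn_f.comp (f := fun w => (x t, w)) (by fun_prop) fun w hw => ⟨hxt, hw⟩)
  have hB0 : 0 ≤ B := (norm_nonneg _).trans (hB (u 0) (hu.1 0 le_rfl))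
  -- One third pays for the variation of the velocity, one for the linearization error of `Y`, and
  -- one keeps the final inequality strict.
  set ε := (r - C * Y (x t)) / 3 with hε
  have hεpos : 0 < ε := by rw [hε]; linarith
  have hDpos : 0 < ‖D‖ + 1 := by positivity
  set η := min 1 (ε / (‖D‖ + 1)) with hη
  have hηpos : 0 < η := lt_min one_pos (by positivity)
  have hηε : ‖D‖ * η ≤ ε := by
    have h1 : η ≤ ε / (‖D‖ + 1) := min_le_right _ _
    rw [le_div_iff₀ hDpos] at h1
    nlinarith
  -- The half-space gives the growth rate; the ball bounds the displacement, as needed in the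
  -- linearization error.
  have hQ : Convex ℝ ({v | D v ≤ C * Y (x t) + ε} ∩ Metric.closedBall 0 (B + 1)) :=
    (convex_halfSpace_le D.toLinearMap.isLinear _).inter (convex_closedBall _ _)
  have hQc : IsClosed ({v | D v ≤ C * Y (x t) + ε} ∩ Metric.closedBall 0 (B + 1)) :=
    (isClosed_le D.continuous continuous_const).inter Metric.isClosed_closedBall
  have hnear := eventually_forall_mem_Ioc ((hx.tendsto_nhdsGT ht).eventually
    (eventually_norm_sub_lt hsys.isCompact_U hsys.continuousOn_f hxt hηpos))
  have hlin := ((hx.tendsto_nhdsGT ht).mono_right nhdsWithin_le_nhds).eventually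
    (hdiff.isLittleO.def (show (0 : ℝ) < ε / (B + 1) by positivity))
  filter_upwards [hnear, hlin, Ioc_mem_nhdsGT ht.2] with s h1 h2 hs
  have hsub := hx.sub_eq ⟨ht.1, ht.2.le⟩ (show s ∈ Icc 0 T from ⟨ht.1.trans hs.1.le, hs.2⟩)
  have hmem := inv_smul_intervalIntegral_mem hQ hQc hs.1
    (hx.intervalIntegrable ⟨ht.1, ht.2.le⟩ (show s ∈ Icc 0 T from ⟨ht.1.trans hs.1.le, hs.2⟩))
    (fun q hq => by
      have hq0 : u q ∈ U := hu.1 q (ht.1.trans hq.1.le)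
      have h3 := h1 q hq (u q) hq0
      constructor
      · have h4 : D (f (x q) (u q) - f (x t) (u q)) ≤ ε :=
          (le_abs_self _).trans ((D.le_opNorm _).trans
            ((mul_le_mul_of_nonneg_left h3.le (norm_nonneg _)).trans hηε))
        have h5 := hYf _ hxt _ hq0
        rw [map_sub] at h4
        change D _ ≤ _
        linarith
      · rw [mem_closedBall_zero_iff]
        have h4 := norm_le_norm_add_norm_sub' (f (x q) (u q)) (f (x t) (u q))
        have h5 := hB _ hq0
        have h6 : η ≤ 1 := min_le_left _ _
        linarith)
  rw [← hsub] at hmem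
  obtain ⟨h3, h4⟩ := hmem
  have hst : 0 < s - t := sub_pos.2 hs.1
  rw [mem_closedBall_zero_iff, norm_smul, norm_inv, Real.norm_of_nonneg hst.le,
    inv_mul_le_iff₀ hst] at h4
  have h3' : (s - t)⁻¹ * D (x s - x t) ≤ C * Y (x t) + ε := by
    simpa using h3
  have h5 : Y (x s) - Y (x t) - D (x s - x t) ≤ ε * (s - t) := by
    refine (le_abs_self _).trans (h2.trans ?_)
    calc ε / (B + 1) * ‖x s - x t‖ ≤ ε / (B + 1) * ((s - t) * (B + 1)) := by gcongr
      _ = ε * (s - t) := by field_simp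
  rw [inv_mul_le_iff₀ hst] at h3'
  rw [inv_mul_lt_iff₀ hst]
  have h6 : r = C * Y (x t) + 3 * ε := by rw [hε]; ring
  rw [h6]
  nlinarith

/-- Trajectories from a given initial point remain in a fixed compact set on bounded time
intervals. -/
theorem exists_isCompact_forall_trajectory (hsys : SystemAssumption U G G₁ f) (hx₀ : x₀ ∈ G)
    (M : ℝ) : ∃ Z, IsCompact Z ∧ Z ⊆ G₁ ∧ Z ⊆ closure G ∧ ∀ u T x, IsControl U u → T ≤ M →
      IsTrajectory G₁ f u x₀ (Icc 0 T) x → ∀ t ∈ Icc 0 T, x t ∈ Z := by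
  obtain ⟨Y, hY, hY0, hYp, C, hC, hYf⟩ := hsys.growth
  refine ⟨(G₁ ∩ Y ⁻¹' Icc 0 (Y x₀ * Real.exp (C * M))) ∩ closure G,
    (hYp _ isCompact_Icc).inter_right isClosed_closure, fun y hy => hy.1.1, fun y hy => hy.2, ?_⟩
  intro u T x hu hT hx t ht
  refine ⟨⟨(hx t ht).1, hY0 _ (hx t ht).1, ?_⟩, hx.mem_closure hsys hu hx₀ ht⟩
  refine (hx.growth_bound hsys hu hY hYf ht).trans ?_
  have := hY0 x₀ (hsys.closure_subset (subset_closure hx₀))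
  have := ht.2.trans hT
  gcongr

/-- Both trajectories lie in a common compact set, where a single Lipschitz constant is available;
Gronwall applied to the norm of their difference, which starts at zero, finishes. -/
theorem IsTrajectory.eqOn (hsys : SystemAssumption U G G₁ f) (hu : IsControl U u)
    (hx₀ : x₀ ∈ G) (hx : IsTrajectory G₁ f u x₀ (Icc 0 T) x)
    (hz : IsTrajectory G₁ f u x₀ (Icc 0 T) z) : EqOn x z (Icc 0 T) := by
  intro t ht
  have hT : 0 ≤ T := ht.1.trans ht.2
  obtain ⟨Z, hZ, -, hZG, hZm⟩ := exists_isCompact_forall_trajectory hsys hx₀ T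
  obtain ⟨R, hR, hZR⟩ := hZ.isBounded.subset_closedBall_lt 0 0
  obtain ⟨C, hC, hlip⟩ := hsys.lipschitz_f R hR
  have hxm : ∀ s ∈ Icc 0 T, x s ∈ Metric.closedBall 0 R ∩ closure G := fun s hs =>
    ⟨hZR (hZm u T x hu le_rfl hx s hs), hZG (hZm u T x hu le_rfl hx s hs)⟩
  have hzm : ∀ s ∈ Icc 0 T, z s ∈ Metric.closedBall 0 R ∩ closure G := fun s hs =>
    ⟨hZR (hZm u T z hu le_rfl hz s hs), hZG (hZm u T z hu le_rfl hz s hs)⟩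
  have h0 : ‖x 0 - z 0‖ ≤ 0 := by
    rw [hx.apply_zero ⟨le_rfl, hT⟩, hz.apply_zero ⟨le_rfl, hT⟩]; simp
  have hcont : ContinuousOn (fun s => ‖x s - z s‖) (Icc 0 T) :=
    ((hx.continuousOn hT).sub (hz.continuousOn hT)).norm
  have := le_gronwallBound_of_liminf_deriv_right_le (f' := fun s => C * ‖x s - z s‖) (δ := 0)
    (K := C) (ε := 0) hcont ?_ h0 (by simp) t ht
  · rw [gronwallBound_ε0, zero_mul] at this
    exact sub_eq_zero.1 (norm_le_zero_iff.1 this)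
  intro t ht r hr
  refine Eventually.frequently ?_
  have hlim : Tendsto (fun s => C * ‖x s - z s‖) (𝓝[>] t) (𝓝 (C * ‖x t - z t‖)) :=
    ((((hx.tendsto_nhdsGT ht).mono_right nhdsWithin_le_nhds).sub
      ((hz.tendsto_nhdsGT ht).mono_right nhdsWithin_le_nhds)).norm).const_mul C
  obtain ⟨q, hq, hqr⟩ := exists_between hr
  filter_upwards [eventually_forall_mem_Ioc (hlim.eventually (gt_mem_nhds hq)),
    Ioc_mem_nhdsGT ht.2] with s h1 hs
  have hs' : s ∈ Icc 0 T := ⟨ht.1.trans hs.1.le, hs.2⟩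
  have ht' : t ∈ Icc 0 T := ⟨ht.1, ht.2.le⟩
  have hst : 0 < s - t := sub_pos.2 hs.1
  have h2 : ‖(x s - z s) - (x t - z t)‖ ≤ q * (s - t) := by
    rw [sub_sub_sub_comm, hx.sub_eq ht' hs', hz.sub_eq ht' hs',
      ← intervalIntegral.integral_sub (hx.intervalIntegrable ht' hs')
        (hz.intervalIntegrable ht' hs')]
    have h3 := intervalIntegral.norm_integral_le_of_norm_le_const (a := t) (b := s) (C := q)
      (f := fun p => f (x p) (u p) - f (z p) (u p)) fun p hp => by
        rw [uIoc_of_le hs.1.le] at hp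
        have hp' : p ∈ Icc 0 T := ⟨ht.1.trans hp.1.le, hp.2.trans hs.2⟩
        exact (hlip _ (hxm p hp') _ (hzm p hp') _ (hu.1 p hp'.1)).trans (h1 p hp).le
    rwa [abs_of_pos hst] at h3
  have h3 := norm_sub_norm_le (x s - z s) (x t - z t)
  rw [inv_mul_lt_iff₀ hst]
  nlinarith

/-! ### Exit times -/

/-- A trajectory that reaches a closed set does so for the first time at the exit time. -/
theorem IsTrajectory.exists_exitTime (hsys : SystemAssumption U G G₁ f) (hK : IsClosed K)
    (hu : IsControl U u) (hx₀ : x₀ ∈ G) (hT : 0 ≤ T)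
    (hx : IsTrajectory G₁ f u x₀ (Icc 0 T) x) (hxT : x T ∈ K) :
    ∃ τ ∈ Icc 0 T, exitTime G₁ f K x₀ u = ENNReal.ofReal τ ∧ x τ ∈ K ∧
      ∀ t ∈ Ico 0 τ, x t ∉ K := by
  have hA : IsCompact (Icc 0 T ∩ x ⁻¹' K) :=
    isCompact_Icc.of_isClosed_subset
      ((hx.continuousOn hT).preimage_isClosed_of_isClosed isClosed_Icc hK) inter_subset_left
  -- The least hitting time along this trajectory is the exit time, because by uniqueness no other
  -- trajectory for `u` can hit `K` earlier.
  obtain ⟨τ, ⟨hτ, hτK⟩, hmin⟩ := hA.exists_isLeast ⟨T, ⟨hT, le_rfl⟩, hxT⟩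
  refine ⟨τ, hτ, le_antisymm ?_ ?_, hτK, fun t ht htK => ?_⟩
  · exact sInf_le ⟨τ, hτ.1, rfl, x, hx.mono (Icc_subset_Icc_right hτ.2), hτK⟩
  · refine le_sInf ?_
    rintro _ ⟨T', hT', rfl, z, hz, hzK⟩
    by_contra! hlt
    have hlt' : T' < τ := ((ENNReal.ofReal_lt_ofReal_iff_of_nonneg hT').1 hlt)
    have heq := (hx.mono (Icc_subset_Icc_right (hlt'.le.trans hτ.2))).eqOn hsys hu hx₀ hz
      ⟨hT', le_rfl⟩
    have := hmin ⟨⟨hT', hlt'.le.trans hτ.2⟩, show x T' ∈ K from heq ▸ hzK⟩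
    linarith
  · have := hmin ⟨⟨ht.1, ht.2.le.trans hτ.2⟩, htK⟩
    linarith [ht.2]

theorem cost_mono {τ : ℝ} (h : τ ≤ T) : cost g c x u τ ≤ cost g c x u T :=
  add_le_add_left (lintegral_mono_set (Icc_subset_Icc_right h)) _

/-- Stopping at the exit time does not increase the cost. -/
theorem IsFreeTimeCost.exists_exit (hsys : SystemAssumption U G G₁ f) (hK : IsClosed K)
    (hx₀ : x₀ ∈ G) {J : ℝ≥0∞} (h : IsFreeTimeCost U G₁ f g c K x₀ u T J) :
    ∃ τ x, 0 ≤ τ ∧ IsTrajectory G₁ f u x₀ (Icc 0 τ) x ∧ x τ ∈ K ∧ (∀ t ∈ Ico 0 τ, x t ∉ K) ∧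
      cost g c x u τ ≤ J ∧ IsExitCost U G₁ f g c K x₀ u (cost g c x u τ) := by
  obtain ⟨hu, hT, x, hx, hxT, rfl⟩ := h
  obtain ⟨τ, hτ, he, hτK, hlt⟩ := hx.exists_exitTime hsys hK hu hx₀ hT hxT
  have hx' := hx.mono (Icc_subset_Icc_right hτ.2)
  refine ⟨τ, x, hτ.1, hx', hτK, hlt, cost_mono hτ.2, hu, by rw [he]; exact ENNReal.ofReal_lt_top,
    x, ?_, ?_⟩ <;> rw [he, ENNReal.toReal_ofReal hτ.1]
  exact hx'

/-- The exit time is an infimum; closedness of `K` makes it attained, and uniqueness transfers this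
to the given trajectory. -/
theorem IsExitCost.isFreeTimeCost (hsys : SystemAssumption U G G₁ f) (hK : IsClosed K)
    (hx₀ : x₀ ∈ G) {J : ℝ≥0∞} (h : IsExitCost U G₁ f g c K x₀ u J) :
    IsFreeTimeCost U G₁ f g c K x₀ u (exitTime G₁ f K x₀ u).toReal J := by
  obtain ⟨hu, hlt, x, hx, hJ⟩ := h
  refine ⟨hu, ENNReal.toReal_nonneg, x, hx, ?_, hJ⟩
  rw [exitTime, sInf_lt_iff] at hlt
  obtain ⟨_, ⟨T, hT, -, z, hz, hzK⟩, -⟩ := hlt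
  obtain ⟨τ, hτ, he, hτK, -⟩ := hz.exists_exitTime hsys hK hu hx₀ hT hzK
  rw [he, ENNReal.toReal_ofReal hτ.1] at hx ⊢
  rwa [hx.eqOn hsys hu hx₀ (hz.mono (Icc_subset_Icc_right hτ.2)) ⟨hτ.1, le_rfl⟩]

theorem exitValue_eq_freeTimeValue (hsys : SystemAssumption U G G₁ f) (hK : IsClosed K)
    (hx₀ : x₀ ∈ G) : exitValue U G₁ f g c K x₀ = freeTimeValue U G₁ f g c K x₀ := by
  refine le_antisymm (le_sInf ?_) (le_sInf ?_)
  · rintro J ⟨u, T, h⟩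
    obtain ⟨τ, x, -, -, -, -, hle, he⟩ := h.exists_exit hsys hK hx₀
    refine le_trans (sInf_le ?_) hle
    exact ⟨u, he⟩
  · rintro J ⟨u, h⟩
    exact sInf_le ⟨u, _, h.isFreeTimeCost hsys hK hx₀⟩

theorem isOptimalControl_iff (hsys : SystemAssumption U G G₁ f) (hK : IsClosed K)
    (hx₀ : x₀ ∈ G) : IsOptimalControl U G₁ f g c K x₀ u ↔
      ∃ T, IsOptimalPair U G₁ f g c K x₀ u T := by
  unfold IsOptimalControl IsOptimalPair
  rw [exitValue_eq_freeTimeValue hsys hK hx₀]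
  refine ⟨fun h => ⟨_, h.isFreeTimeCost hsys hK hx₀⟩, fun ⟨T, h⟩ => ?_⟩
  obtain ⟨τ, x, -, -, -, -, hle, he⟩ := h.exists_exit hsys hK hx₀
  rw [← exitValue_eq_freeTimeValue hsys hK hx₀] at hle ⊢
  -- The cost at the exit time lies between the value and the optimal cost, which are equal.
  rwa [← le_antisymm hle (csInf_le' (a := cost g c x u τ) ⟨u, he⟩)]

/-- The value is finite if the target can be reached. -/
theorem freeTimeValue_lt_top (hsys : SystemAssumption U G G₁ f) (hcost : CostAssumption U G g K)
    (hx₀ : x₀ ∈ G) (hu : IsControl U u) (hT : 0 ≤ T)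
    (hx : IsTrajectory G₁ f u x₀ (Icc 0 T) x) (hxT : x T ∈ K) :
    freeTimeValue U G₁ f g c K x₀ < ∞ := by
  refine lt_of_le_of_lt (sInf_le ⟨u, T, hu, hT, x, hx, hxT, rfl⟩) ?_
  obtain ⟨Z, hZ, -, hZG, hZm⟩ := exists_isCompact_forall_trajectory hsys hx₀ T
  obtain ⟨B, hB⟩ := (hZ.prod hsys.isCompact_U).exists_bound_of_continuousOn
    (hcost.continuousOn_g.mono (prod_mono hZG le_rfl))
  refine ENNReal.add_lt_top.2 ⟨?_, ENNReal.ofReal_lt_top⟩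
  refine lt_of_le_of_lt (setLIntegral_mono (measurable_const (a := ENNReal.ofReal B))
    fun t ht => ENNReal.ofReal_le_ofReal ((le_abs_self _).trans
      (hB (x t, u t) ⟨hZm u T x hu le_rfl hx t ht, hu.1 t ht.1⟩))) ?_
  rw [setLIntegral_const]
  exact ENNReal.mul_lt_top ENNReal.ofReal_lt_top (by simp)

/-! ### Existence of optimal pairs -/

theorem aestronglyMeasurable_comp_control {X : Type*} [NormedAddCommGroup X]
    [SecondCountableTopology X] {S : Set (EuclideanSpace ℝ (Fin n))}
    {F : EuclideanSpace ℝ (Fin n) → EuclideanSpace ℝ (Fin m) → X}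
    (hF : ContinuousOn (Function.uncurry F) (S ×ˢ U)) (hS : MeasurableSet S)
    (hU : MeasurableSet U) (hu : IsControl U u) (hx : ContinuousOn x (Icc 0 T))
    (hxS : ∀ t ∈ Icc 0 T, x t ∈ S) :
    AEStronglyMeasurable (fun t => F (x t) (u t)) (volume.restrict (Icc 0 T)) := by
  have hφ : AEMeasurable (fun t => (x t, u t)) (volume.restrict (Icc 0 T)) :=
    (hx.aestronglyMeasurable measurableSet_Icc).aemeasurable.prodMk
      (hu.2 T).aestronglyMeasurable.aemeasurable
  have hmem : ∀ᵐ q ∂(Measure.map (fun t => (x t, u t)) (volume.restrict (Icc 0 T))),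
      q ∈ S ×ˢ U := by
    refine (ae_map_iff hφ (hS.prod hU)).2 ((ae_restrict_iff' measurableSet_Icc).2 ?_)
    exact ae_of_all _ fun t ht => ⟨hxS t ht, hu.1 t ht.1⟩
  have h1 := hF.aestronglyMeasurable (hS.prod hU)
    (μ := Measure.map (fun t => (x t, u t)) (volume.restrict (Icc 0 T)))
  rw [Measure.restrict_eq_self_of_ae_mem hmem] at h1
  exact h1.comp_aemeasurable hφ

/-- The trajectory together with its running cost, extended to a Lipschitz curve on the line. -/
theorem IsTrajectory.exists_augmented (hsys : SystemAssumption U G G₁ f)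
    (hcost : CostAssumption U G g K) (hu : IsControl U u) (hT : 0 ≤ T)
    (hx : IsTrajectory G₁ f u x₀ (Icc 0 T) x) {Z : Set (EuclideanSpace ℝ (Fin n))}
    (hZG : Z ⊆ closure G) (hxZ : ∀ t ∈ Icc 0 T, x t ∈ Z) {L : NNReal}
    (hL : ∀ y ∈ Z, ∀ w ∈ U, ‖(f y w, g y w)‖ ≤ L) (c : ℝ) :
    ∃ P v : ℝ → EuclideanSpace ℝ (Fin n) × ℝ, P 0 = (x₀, 0) ∧ LipschitzWith L P ∧
      (∀ a b, IntervalIntegrable v volume a b ∧ P b - P a = ∫ s in a..b, v s) ∧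
      (∀ t ∈ Icc 0 T, (P t).1 = x t) ∧
      (∀ t ∈ Ioc 0 T, v t = (f (x t) (u t), g (x t) (u t))) ∧ 0 ≤ (P T).2 ∧
      cost g c x u T = ENNReal.ofReal (P T).2 + ENNReal.ofReal c := by
  have hxc := hx.continuousOn hT
  set F := fun y w => (f y w, g y w) with hF
  have hFc : ContinuousOn (Function.uncurry F) (closure G ×ˢ U) :=
    (hsys.continuousOn_f.mono (prod_mono hsys.closure_subset le_rfl)).prodMk hcost.continuousOn_g
  have hFm := (aestronglyMeasurable_comp_control hFc isClosed_closure.measurableSet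
    hsys.isCompact_U.measurableSet hu hxc fun t ht => hZG (hxZ t ht)).mono_measure
      (Measure.restrict_mono Ioc_subset_Icc_self le_rfl)
  -- Zero velocity outside `(0, T]` freezes the curve there, so curves with different terminal times
  -- live on the whole line with the same Lipschitz constant.
  set v := (Ioc 0 T).indicator fun t => F (x t) (u t) with hv
  have hvL : ∀ t, ‖v t‖ ≤ L := by
    intro t
    by_cases ht : t ∈ Ioc 0 T
    · rw [hv, indicator_of_mem ht]
      exact hL _ (hxZ t (Ioc_subset_Icc_self ht)) _ (hu.1 t ht.1.le)
    · rw [hv, indicator_of_notMem ht]; simp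
  have hvi : ∀ a b, IntervalIntegrable v volume a b := fun a b =>
    (intervalIntegrable_const (c := (L : ℝ))).mono_fun
      ((aestronglyMeasurable_indicator_iff measurableSet_Ioc).2 hFm).restrict
      (ae_of_all _ fun t => by simpa using hvL t)
  set P := fun t => (x₀, (0 : ℝ)) + ∫ s in (0 : ℝ)..t, v s with hP
  have hPsub : ∀ a b, P b - P a = ∫ s in a..b, v s := fun a b => by
    simp only [hP]
    rw [add_sub_add_left_eq_sub, intervalIntegral.integral_interval_sub_left (hvi _ _) (hvi _ _)]
  have hPt : ∀ t ∈ Icc 0 T, ∫ s in (0 : ℝ)..t, v s = ∫ s in (0 : ℝ)..t, F (x s) (u s) := by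
    intro t ht
    refine intervalIntegral.integral_congr_ae (ae_of_all _ fun s hs => ?_)
    rw [uIoc_of_le ht.1] at hs
    rw [hv, indicator_of_mem (show s ∈ Ioc 0 T from ⟨hs.1, hs.2.trans ht.2⟩)]
  have hFi : ∀ t ∈ Icc 0 T, IntervalIntegrable (fun s => F (x s) (u s)) volume 0 t := by
    intro t ht
    refine (hvi 0 t).congr_ae ?_
    rw [uIoc_of_le ht.1]
    refine (ae_restrict_iff' measurableSet_Ioc).2 (ae_of_all _ fun s hs => ?_)
    rw [hv, indicator_of_mem (show s ∈ Ioc 0 T from ⟨hs.1, hs.2.trans ht.2⟩)]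
  have hTT : T ∈ Icc 0 T := ⟨hT, le_rfl⟩
  have h2 : (P T).2 = ∫ s in Icc 0 T, g (x s) (u s) := by
    have h := (ContinuousLinearMap.snd ℝ (EuclideanSpace ℝ (Fin n)) ℝ).intervalIntegral_comp_comm
      (hFi T hTT)
    simp only [hP, Prod.snd_add, zero_add, hPt T hTT]
    rw [integral_Icc_eq_integral_Ioc, ← intervalIntegral.integral_of_le hT]
    exact h.symm
  have hgi : IntegrableOn (fun s => g (x s) (u s)) (Icc 0 T) volume :=
    (integrableOn_Icc_iff_integrableOn_Ioc (by simp)).2 (hFi T hTT).1.snd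
  have hg0 : ∀ s ∈ Icc 0 T, 0 ≤ g (x s) (u s) := fun s hs =>
    hcost.nonneg_g _ (hZG (hxZ s hs)) _ (hu.1 s hs.1)
  refine ⟨P, v, by simp [hP], ?_, fun a b => ⟨hvi a b, hPsub a b⟩, fun t ht => ?_,
    fun t ht => indicator_of_mem ht _, ?_, ?_⟩
  · refine LipschitzWith.of_dist_le_mul fun s t => ?_
    rw [dist_eq_norm, hPsub, Real.dist_eq]
    exact intervalIntegral.norm_integral_le_of_norm_le_const fun r _ => hvL r
  · have h := (ContinuousLinearMap.fst ℝ (EuclideanSpace ℝ (Fin n)) ℝ).intervalIntegral_comp_comm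
      (hFi t ht)
    simp only [hP, Prod.fst_add, hPt t ht]
    rw [(hx t ht).2.2]
    exact congrArg _ h.symm
  · rw [h2]
    exact setIntegral_nonneg measurableSet_Icc hg0
  · rw [h2, cost, ofReal_integral_eq_lintegral_ofReal hgi
      ((ae_restrict_iff' measurableSet_Icc).2 (ae_of_all _ hg0))]

/-- Before reaching the target, the cost grows at least linearly in time. -/
theorem IsTrajectory.ofReal_le_cost (hsys : SystemAssumption U G G₁ f) (hu : IsControl U u)
    (hx₀ : x₀ ∈ G) {C : ℝ} (hC : ∀ x ∈ G \ interior K, ∀ u ∈ U, C ≤ g x u) (hT : 0 ≤ T)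
    (hx : IsTrajectory G₁ f u x₀ (Icc 0 T) x) (hlt : ∀ t ∈ Ico 0 T, x t ∉ K) :
    ENNReal.ofReal C * ENNReal.ofReal T ≤ cost g c x u T := by
  rcases hT.eq_or_lt with rfl | hT'
  · simp
  have hG := hsys.invariant u hu x₀ hx₀ T hT' x (hx.mono Ico_subset_Icc_self)
  calc ENNReal.ofReal C * ENNReal.ofReal T
      = ∫⁻ _ in Ico 0 T, ENNReal.ofReal C := by simp
    _ ≤ ∫⁻ t in Ico 0 T, ENNReal.ofReal (g (x t) (u t)) :=
        setLIntegral_mono' measurableSet_Ico fun t ht => ENNReal.ofReal_le_ofReal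
          (hC _ ⟨hG t ht, fun h => hlt t ht (interior_subset h)⟩ _ (hu.1 t ht.1))
    _ ≤ ∫⁻ t in Icc 0 T, ENNReal.ofReal (g (x t) (u t)) := lintegral_mono_set Ico_subset_Icc_self
    _ ≤ cost g c x u T := le_self_add

/-- The set is the sum of a compact image of `U` and a closed vertical ray. -/
theorem isClosed_extendedVelocity (hU : IsCompact U) {y : EuclideanSpace ℝ (Fin n)}
    (hf : ContinuousOn (f y) U) (hg : ContinuousOn (g y) U) :
    IsClosed {p : EuclideanSpace ℝ (Fin n) × ℝ | ∃ u ∈ U, p.1 = f y u ∧ g y u ≤ p.2} := by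
  have h1 : IsCompact ((fun w => (f y w, g y w)) '' U) := hU.image_of_continuousOn (hf.prodMk hg)
  have h2 : IsClosed {p : EuclideanSpace ℝ (Fin n) × ℝ | p.1 = 0 ∧ 0 ≤ p.2} :=
    (isClosed_eq continuous_fst continuous_const).inter
      (isClosed_le continuous_const continuous_snd)
  convert h2.add_left_of_isCompact h1 using 1
  ext p
  rw [Set.mem_add]
  simp only [mem_ofPred_eq]
  constructor
  · rintro ⟨w, hw, hp, hle⟩
    exact ⟨_, mem_image_of_mem _ hw, (0, p.2 - g y w), ⟨rfl, by simpa using hle⟩,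
      by ext1 <;> simp [hp]⟩
  · rintro ⟨_, ⟨w, hw, rfl⟩, q, ⟨hq1, hq2⟩, rfl⟩
    exact ⟨w, hw, by simp [hq1], by simpa using hq2⟩

/-- A Lipschitz curve whose velocities are extended velocities is realized by a control. -/
theorem exists_control_of_deriv_mem (hsys : SystemAssumption U G G₁ f)
    (hcost : CostAssumption U G g K) (hUne : U.Nonempty) (hT : 0 ≤ T) {L : NNReal}
    {p : ℝ → EuclideanSpace ℝ (Fin n) × ℝ} (hp : LipschitzWith L p) (hp0 : p 0 = (x₀, 0))
    (hpG : ∀ t ∈ Icc 0 T, (p t).1 ∈ closure G)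
    (hder : ∀ᵐ t ∂volume.restrict (Ioc 0 T),
      ∃ w ∈ U, (deriv p t).1 = f (p t).1 w ∧ g (p t).1 w ≤ (deriv p t).2) :
    ∃ u, IsControl U u ∧ IsTrajectory G₁ f u x₀ (Icc 0 T) (fun t => (p t).1) ∧
      cost g c (fun t => (p t).1) u T ≤ ENNReal.ofReal (p T).2 + ENNReal.ofReal c := by
  -- Clamping time keeps the state in `closure G` for all `t`, where `f` and `g` are continuous.
  set ξ := fun t => (p (projIcc 0 T hT t)).1 with hξ
  have hξc : Continuous ξ :=
    continuous_fst.comp (hp.continuous.comp (continuous_subtype_val.comp continuous_projIcc))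
  have hξG : ∀ t, ξ t ∈ closure G := fun t => hpG _ (projIcc 0 T hT t).2
  have hξp : ∀ t ∈ Icc 0 T, ξ t = (p t).1 := fun t ht => by simp [hξ, projIcc_of_mem hT ht]
  have hf' := hsys.continuousOn_f.mono (prod_mono hsys.closure_subset (le_refl U))
  have hg' := hcost.continuousOn_g
  obtain ⟨σ, hσ, hσU, hσz⟩ := exists_measurable_ae_zero (μ := volume.restrict (Ioc 0 T))
    hsys.isCompact_U hUne
    -- Vanishing of this sum encodes both the velocity equation and the cost inequality.
    (h := fun t w => ‖f (ξ t) w - (deriv p t).1‖ + max 0 (g (ξ t) w - (deriv p t).2))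
    (fun w hw => by
      have h1 : Continuous fun t => f (ξ t) w :=
        hf'.comp_continuous (f := fun t => (ξ t, w)) (by fun_prop) fun t => ⟨hξG t, hw⟩
      have h2 : Continuous fun t => g (ξ t) w :=
        hg'.comp_continuous (f := fun t => (ξ t, w)) (by fun_prop) fun t => ⟨hξG t, hw⟩
      exact (h1.measurable.sub (measurable_deriv p).fst).norm.add
        (measurable_const.max (h2.measurable.sub (measurable_deriv p).snd)))
    (fun t => by
      have h1 : ContinuousOn (f (ξ t)) U :=
        hf'.comp (f := fun w => (ξ t, w)) (by fun_prop) fun w hw => ⟨hξG t, hw⟩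
      have h2 : ContinuousOn (g (ξ t)) U :=
        hg'.comp (f := fun w => (ξ t, w)) (by fun_prop) fun w hw => ⟨hξG t, hw⟩
      exact (h1.sub continuousOn_const).norm.add
        (ContinuousOn.sup continuousOn_const (h2.sub continuousOn_const)))
    (fun t w _ => by positivity)
    (by
      filter_upwards [hder, ae_restrict_mem measurableSet_Ioc] with t ht htm
      obtain ⟨w, hw, h1, h2⟩ := ht
      refine ⟨w, hw, ?_⟩
      rw [hξp t (Ioc_subset_Icc_self htm), h1, sub_self, norm_zero, zero_add,
        max_eq_left (sub_nonpos.2 h2)])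
  have hae : ∀ᵐ t ∂volume.restrict (Ioc 0 T),
      (deriv p t).1 = f (p t).1 (σ t) ∧ g (p t).1 (σ t) ≤ (deriv p t).2 := by
    filter_upwards [hσz, ae_restrict_mem measurableSet_Ioc] with t ht htm
    rw [hξp t (Ioc_subset_Icc_self htm)] at ht
    have h1 := norm_nonneg (f (p t).1 (σ t) - (deriv p t).1)
    have h2 := le_max_left 0 (g (p t).1 (σ t) - (deriv p t).2)
    have h3 := le_max_right 0 (g (p t).1 (σ t) - (deriv p t).2)
    refine ⟨(sub_eq_zero.1 (norm_le_zero_iff.1 (by linarith))).symm, by linarith⟩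
  have hFTC := integral_deriv_of_lipschitzWith hp
  refine ⟨σ, ⟨fun t _ => hσU t, fun S => ?_⟩, fun t ht => ?_, ?_⟩
  · obtain ⟨B, hB⟩ := hsys.isCompact_U.isBounded.exists_norm_le
    exact memLp_top_of_bound hσ.aestronglyMeasurable B (ae_of_all _ fun t => hB _ (hσU t))
  · have hi := (hFTC 0 t).1
    have hi1 : IntervalIntegrable (fun s => (deriv p s).1) volume 0 t := ⟨hi.1.fst, hi.2.fst⟩
    have heq : (fun s => (deriv p s).1) =ᵐ[volume.restrict (uIoc 0 t)]
        fun s => f (p s).1 (σ s) := by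
      rw [uIoc_of_le ht.1]
      filter_upwards [ae_restrict_of_ae_restrict_of_subset (Ioc_subset_Ioc_right ht.2) hae]
        with s hs using hs.1
    refine ⟨hsys.closure_subset (hpG t ht), hi1.congr_ae heq, ?_⟩
    rw [← intervalIntegral.integral_congr_ae_restrict heq]
    have h :=
        (ContinuousLinearMap.fst ℝ (EuclideanSpace ℝ (Fin n)) ℝ).intervalIntegral_comp_comm hi
    rw [(hFTC 0 t).2, hp0] at h
    have h' : ∫ s in (0 : ℝ)..t, (deriv p s).1 = (p t).1 - x₀ := h
    rw [h', add_sub_cancel]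
  · refine add_le_add_left ?_ _
    have hi := (hFTC 0 T).1
    have hi2 : IntegrableOn (fun s => (deriv p s).2) (Ioc 0 T) volume := hi.1.snd
    have h0 : 0 ≤ᵐ[volume.restrict (Ioc 0 T)] fun s => (deriv p s).2 := by
      filter_upwards [hae, ae_restrict_mem measurableSet_Ioc] with s hs hsm
      exact (hcost.nonneg_g _ (hpG s (Ioc_subset_Icc_self hsm)) _ (hσU s)).trans hs.2
    have h2 : (p T).2 = ∫ s in Ioc 0 T, (deriv p s).2 := by
      have h :=
        (ContinuousLinearMap.snd ℝ (EuclideanSpace ℝ (Fin n)) ℝ).intervalIntegral_comp_comm hi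
      rw [(hFTC 0 T).2, hp0] at h
      have h' : ∫ s in (0 : ℝ)..T, (deriv p s).2 = (p T).2 - 0 := h
      rw [← intervalIntegral.integral_of_le hT, h', sub_zero]
    rw [h2, ofReal_integral_eq_lintegral_ofReal hi2 h0, ← restrict_Ioc_eq_restrict_Icc]
    exact lintegral_mono_ae (hae.mono fun s hs => ENNReal.ofReal_le_ofReal hs.2)

/-- Pointwise limits along an ultrafilter of uniformly Lipschitz curves with a common initial
point. -/
theorem exists_tendsto_of_lipschitzWith {ι X : Type*} [NormedAddCommGroup X] [ProperSpace X]
    (l : Ultrafilter ι) {L : NNReal} {P : ι → ℝ → X} {a : X} (hP : ∀ k, LipschitzWith L (P k))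
    (h0 : ∀ k, P k 0 = a) :
    ∃ p : ℝ → X, LipschitzWith L p ∧ p 0 = a ∧
      ∀ (s : ι → ℝ) (t : ℝ), Tendsto s l (𝓝 t) → Tendsto (fun k => P k (s k)) l (𝓝 (p t)) := by
  have hex : ∀ t : ℝ, ∃ q, Tendsto (fun k => P k t) l (𝓝 q) := by
    intro t
    have hmem : ∀ k, P k t ∈ Metric.closedBall a (L * |t|) := fun k => by
      have := (hP k).dist_le_mul t 0
      rwa [h0, Real.dist_eq, sub_zero] at this
    obtain ⟨q, -, hq⟩ := (isCompact_closedBall a (L * |t|)).ultrafilter_le_nhds'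
      (l.map fun k => P k t) (Filter.univ_mem' (f := (l : Filter ι)) hmem)
    exact ⟨q, hq⟩
  choose p hp using hex
  refine ⟨p, LipschitzWith.of_dist_le_mul fun s t => ?_, ?_, fun s t hs => ?_⟩
  · exact le_of_tendsto ((hp s).dist (hp t)) (.of_forall fun k => (hP k).dist_le_mul s t)
  · exact tendsto_nhds_unique (hp 0) (by simp [h0])
  · have h1 : Tendsto (fun k => dist (P k (s k)) (P k t)) l (𝓝 0) := by
      refine squeeze_zero (fun k => dist_nonneg) (fun k => (hP k).dist_le_mul (s k) t) ?_
      simpa using (tendsto_iff_dist_tendsto_zero.1 hs).const_mul (L : ℝ)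
    exact (tendsto_iff_of_dist (by simpa only [dist_comm] using h1)).1 (hp t)

/-- **Existence of optimal pairs** (Filippov). -/
theorem exists_isOptimalPair (hsys : SystemAssumption U G G₁ f) (hK : IsClosed K)
    (hcost : CostAssumption U G g K) (hconv : ConvexityAssumption U G f g) (hx₀ : x₀ ∈ G)
    (hfin : freeTimeValue U G₁ f g c K x₀ < ∞) :
    ∃ u T, IsOptimalPair U G₁ f g c K x₀ u T := by
  set val := freeTimeValue U G₁ f g c K x₀ with hval
  obtain ⟨C, hC, hgC⟩ := hcost.inf_pos
  have hmin : ∀ k : ℕ, ∃ u T x, IsControl U u ∧ 0 ≤ T ∧ IsTrajectory G₁ f u x₀ (Icc 0 T) x ∧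
      x T ∈ K ∧ (∀ t ∈ Ico 0 T, x t ∉ K) ∧
      cost g c x u T ≤ val + ENNReal.ofReal (1 / ((k : ℝ) + 1)) := by
    intro k
    have h1 : val < val + ENNReal.ofReal (1 / ((k : ℝ) + 1)) :=
      ENNReal.lt_add_right hfin.ne (ENNReal.ofReal_pos.2 (by positivity)).ne'
    rw [hval, freeTimeValue, sInf_lt_iff] at h1
    obtain ⟨J, ⟨u, T, hJ⟩, hlt⟩ := h1
    obtain ⟨τ, x, hτ, hx, hxK, hnot, hle, -⟩ := hJ.exists_exit hsys hK hx₀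
    exact ⟨u, τ, x, hJ.1, hτ, hx, hxK, hnot, hle.trans hlt.le⟩
  choose u T x hu hT hx hxK hnot hcst using hmin
  -- The stopped costs are at most `val + 1` and grow at rate at least `C` before exit.
  set M := (val.toReal + 1) / C with hM
  have hcst' : ∀ k, cost g c (x k) (u k) (T k) ≤
      ENNReal.ofReal (val.toReal + 1 / ((k : ℝ) + 1)) := fun k => by
    rw [ENNReal.ofReal_add ENNReal.toReal_nonneg (by positivity), ENNReal.ofReal_toReal hfin.ne]
    exact hcst k
  have hTM : ∀ k, T k ≤ M := by
    intro k
    have h1 := ((hx k).ofReal_le_cost hsys (hu k) hx₀ (c := c) hgC (hT k) (hnot k)).trans (hcst' k)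
    have h2 : (1 : ℝ) / ((k : ℝ) + 1) ≤ 1 := by
      rw [div_le_one (by positivity)]; linarith [(Nat.cast_nonneg k : (0 : ℝ) ≤ k)]
    have h3 : (0 : ℝ) ≤ val.toReal := ENNReal.toReal_nonneg
    rw [← ENNReal.ofReal_mul hC.le, ENNReal.ofReal_le_ofReal_iff (by positivity)] at h1
    rw [hM, le_div_iff₀ hC]
    linarith
  obtain ⟨Z, hZ, -, hZG, hZm⟩ := exists_isCompact_forall_trajectory hsys hx₀ M
  have hxZ : ∀ k, ∀ t ∈ Icc 0 (T k), x k t ∈ Z := fun k =>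
    hZm (u k) (T k) (x k) (hu k) (hTM k) (hx k)
  have hFc : ContinuousOn (Function.uncurry fun y w => (f y w, g y w)) (closure G ×ˢ U) :=
    (hsys.continuousOn_f.mono (prod_mono hsys.closure_subset le_rfl)).prodMk hcost.continuousOn_g
  obtain ⟨L, hL⟩ : ∃ L : NNReal, ∀ y ∈ Z, ∀ w ∈ U, ‖(f y w, g y w)‖ ≤ L := by
    obtain ⟨B, hB⟩ := (hZ.prod hsys.isCompact_U).exists_bound_of_continuousOn
      (hFc.mono (prod_mono hZG le_rfl))
    exact ⟨B.toNNReal, fun y hy w hw => (hB (y, w) ⟨hy, hw⟩).trans (Real.le_coe_toNNReal B)⟩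
  choose P v hP0 hPL hPv hPx hv hP2 hPc using fun k =>
    (hx k).exists_augmented hsys hcost (hu k) (hT k) hZG (hxZ k) hL c
  -- A nonprincipal ultrafilter makes the terminal times and all the curves converge at once,
  -- without extracting subsequences.
  set l := hyperfilter ℕ with hl
  obtain ⟨p, hpL, hp0, hplim⟩ := exists_tendsto_of_lipschitzWith l hPL hP0
  obtain ⟨τ, hτ, hτlim⟩ : ∃ τ ∈ Icc 0 M, Tendsto T l (𝓝 τ) :=
    isCompact_Icc.ultrafilter_le_nhds' (l.map T)
      (Filter.univ_mem' (f := (l : Filter ℕ)) fun k => ⟨hT k, hTM k⟩)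
  have hpZ : ∀ t ∈ Icc 0 τ, (p t).1 ∈ Z := by
    intro t ht
    -- When `t = τ`, the time `T k` may fall short of `t`; clamping keeps the evaluation inside the
    -- actual trajectory.
    have h1 : Tendsto (fun k => min t (T k)) l (𝓝 t) := by
      simpa [min_eq_left ht.2] using (tendsto_const_nhds (x := t)).min hτlim
    refine hZ.isClosed.mem_of_tendsto ((continuous_fst.tendsto _).comp (hplim _ t h1))
      (.of_forall fun k => ?_)
    have h2 : min t (T k) ∈ Icc 0 (T k) := ⟨le_min ht.1 (hT k), min_le_right _ _⟩
    simpa [hPx k _ h2] using hxZ k _ h2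
  have hpK : (p τ).1 ∈ K := by
    refine hK.mem_of_tendsto ((continuous_fst.tendsto _).comp (hplim _ τ hτlim))
      (.of_forall fun k => ?_)
    simpa [hPx k _ ⟨hT k, le_rfl⟩] using hxK k
  have hpval : ENNReal.ofReal (p τ).2 + ENNReal.ofReal c ≤ val := by
    have h1 : Tendsto (fun k => ENNReal.ofReal (P k (T k)).2 + ENNReal.ofReal c) l
        (𝓝 (ENNReal.ofReal (p τ).2 + ENNReal.ofReal c)) :=
      ((ENNReal.continuous_ofReal.tendsto _).comp
        ((continuous_snd.tendsto _).comp (hplim _ τ hτlim))).add tendsto_const_nhds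
    have h2 : Tendsto (fun k : ℕ => ENNReal.ofReal (val.toReal + 1 / ((k : ℝ) + 1))) l
        (𝓝 (ENNReal.ofReal (val.toReal + 0))) :=
      (ENNReal.continuous_ofReal.tendsto _).comp ((tendsto_const_nhds.add
        tendsto_one_div_add_atTop_nhds_zero_nat).mono_left Nat.hyperfilter_le_atTop)
    rw [add_zero, ENNReal.ofReal_toReal hfin.ne] at h2
    exact le_of_tendsto_of_tendsto' h1 h2 fun k => hPc k ▸ hcst' k
  have hder : ∀ᵐ t ∂volume.restrict (Ioc 0 τ),
      ∃ w ∈ U, (deriv p t).1 = f (p t).1 w ∧ g (p t).1 w ≤ (deriv p t).2 := by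
    -- Dropping the endpoint leaves room to the right of `t`, so that short intervals lie before `T
    -- k` for most `k`.
    rw [← Measure.restrict_congr_set Ioo_ae_eq_Ioc]
    filter_upwards [ae_restrict_mem measurableSet_Ioo,
      ae_restrict_of_ae hpL.ae_differentiableAt_real] with t ht hdiff
    have hξ : (p t).1 ∈ closure G := hZG (hpZ t (Ioo_subset_Icc_self ht))
    refine deriv_mem_of_tendsto (l := (l : Filter ℕ)) (P := P) (v := v) (p := p) (t := t)
      (Q := {q | ∃ w ∈ U, q.1 = f (p t).1 w ∧ g (p t).1 w ≤ q.2}) (hconv _ hξ)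
      (isClosed_extendedVelocity hsys.isCompact_U ?_ ?_)
      (fun s => hplim _ s tendsto_const_nhds) hdiff.hasDerivAt (fun k s => hPv k t s) ?_
    · exact hsys.continuousOn_f.comp (f := fun w => ((p t).1, w)) (by fun_prop)
        fun w hw => ⟨hsys.closure_subset hξ, hw⟩
    · exact hcost.continuousOn_g.comp (f := fun w => ((p t).1, w)) (by fun_prop)
        fun w hw => ⟨hξ, hw⟩
    intro ε hε
    obtain ⟨ρ, hρ, hnear⟩ := Metric.mem_nhdsWithin_iff.1
      (eventually_norm_sub_lt hsys.isCompact_U hFc hξ hε)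
    -- Half of `ρ` absorbs the Lipschitz displacement over `(t, s]`, the other half the distance
    -- from `P k t` to `p t`.
    refine ⟨min (τ - t) (ρ / 2 / (L + 1)), lt_min (sub_pos.2 ht.2) (by positivity),
      fun s hs => ?_⟩
    have hs1 : s < τ := by linarith [hs.2, min_le_left (τ - t) (ρ / 2 / (L + 1))]
    have hs2 : s - t < ρ / 2 / (L + 1) := by
      linarith [hs.2, min_le_right (τ - t) (ρ / 2 / (L + 1))]
    rw [lt_div_iff₀ (by positivity)] at hs2
    filter_upwards [hτlim.eventually (lt_mem_nhds hs1),
      (hplim _ t tendsto_const_nhds).eventually (Metric.ball_mem_nhds _ (half_pos hρ))]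
      with k hk1 hk2 r hr
    have hr' : r ∈ Ioc 0 (T k) := ⟨ht.1.trans hr.1, hr.2.trans hk1.le⟩
    have hrU : u k r ∈ U := (hu k).1 r hr'.1.le
    have hxr := hPx k r (Ioc_subset_Icc_self hr')
    have hdist : dist (x k r) (p t).1 < ρ := by
      rw [← hxr]
      have h1 := (hPL k).dist_le_mul r t
      have h2 := dist_triangle (P k r) (P k t) (p t)
      have h3 : dist (P k r).1 (p t).1 ≤ dist (P k r) (p t) := le_max_left _ _
      rw [Real.dist_eq, abs_of_pos (sub_pos.2 hr.1)] at h1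
      have h4 : (L : ℝ) * (r - t) ≤ L * (s - t) := by
        have := hr.2
        gcongr
      have h5 : dist (P k t) (p t) < ρ / 2 := hk2
      have h6 := hs.1
      nlinarith
    -- The nearby extended velocity uses the same control value `u k r` at the limit state.
    refine Metric.mem_cthickening_of_dist_le _ (f (p t).1 (u k r), g (p t).1 (u k r)) _ _
      ⟨u k r, hrU, rfl, le_rfl⟩ ?_
    rw [hv k r hr', dist_eq_norm]
    exact (hnear ⟨hdist, hZG (hxZ k r (Ioc_subset_Icc_self hr'))⟩ _ hrU).le
  obtain ⟨σ, hσ, hσx, hσc⟩ := exists_control_of_deriv_mem (c := c) hsys hcost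
    ⟨u 0 0, (hu 0).1 0 le_rfl⟩ hτ.1 hpL hp0 (fun t ht => hZG (hpZ t ht)) hder
  refine ⟨σ, τ, hσ, hτ.1, _, hσx, hpK, le_antisymm (sInf_le ?_) (hσc.trans hpval)⟩
  exact ⟨σ, τ, hσ, hτ.1, _, hσx, hpK, rfl⟩

/-! ### The target of the local control Lyapunov function -/

theorem LocalCLFAssumption.isClosed_sublevel {Ω : Set (EuclideanSpace ℝ (Fin n))}
    {V : EuclideanSpace ℝ (Fin n) → ℝ} (h : LocalCLFAssumption U G f Ω V c) :
    IsClosed (sublevel Ω V c) := by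
  rw [← h.closure_strict]
  exact isClosed_closure

theorem LocalCLFAssumption.sublevel_mem_nhds_zero {Ω : Set (EuclideanSpace ℝ (Fin n))}
    {V : EuclideanSpace ℝ (Fin n) → ℝ} (h : LocalCLFAssumption U G f Ω V c) :
    sublevel Ω V c ∈ 𝓝 0 := by
  refine mem_of_superset (h.domain_strict.1.mem_nhds ⟨subset_closure h.zero_mem, ?_⟩)
    fun y hy => ⟨hy.1, hy.2.le⟩
  rw [h.posDef_V.1]
  exact h.c_pos

end ExitTime

/-! ### The main theorem -/

theorem theorem2p24 {n m : ℕ}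
    (U : Set (EuclideanSpace ℝ (Fin m))) (G G₁ : Set (EuclideanSpace ℝ (Fin n)))
    (f : EuclideanSpace ℝ (Fin n) → EuclideanSpace ℝ (Fin m) → EuclideanSpace ℝ (Fin n))
    (Ω : Set (EuclideanSpace ℝ (Fin n))) (V : EuclideanSpace ℝ (Fin n) → ℝ) (c : ℝ)
    (g : EuclideanSpace ℝ (Fin n) → EuclideanSpace ℝ (Fin m) → ℝ)
    (hsys : ExitTime.SystemAssumption U G G₁ f)
    (hloc : ExitTime.LocalCLFAssumption U G f Ω V c)
    (hcost : ExitTime.CostAssumption U G g (ExitTime.sublevel Ω V c))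
    (hconv : ExitTime.ConvexityAssumption U G f g)
    (x₀ : EuclideanSpace ℝ (Fin n))
    (hx₀ : x₀ ∈ ExitTime.nullControllable U G G₁ f \ ExitTime.sublevel Ω V c) :
    ExitTime.exitValue U G₁ f g c (ExitTime.sublevel Ω V c) x₀ < ∞ ∧
    ExitTime.exitValue U G₁ f g c (ExitTime.sublevel Ω V c) x₀ =
      ExitTime.freeTimeValue U G₁ f g c (ExitTime.sublevel Ω V c) x₀ ∧
    (∃ u, ExitTime.IsOptimalControl U G₁ f g c (ExitTime.sublevel Ω V c) x₀ u) ∧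
    (∃ u T, ExitTime.IsOptimalPair U G₁ f g c (ExitTime.sublevel Ω V c) x₀ u T) ∧
    (∀ u, ExitTime.IsOptimalControl U G₁ f g c (ExitTime.sublevel Ω V c) x₀ u ↔
      ∃ T, ExitTime.IsOptimalPair U G₁ f g c (ExitTime.sublevel Ω V c) x₀ u T) := by
  obtain ⟨⟨hxG, u, hu, x, hx, hlim⟩, -⟩ := hx₀
  have hK := hloc.isClosed_sublevel
  obtain ⟨T, hxT, hT⟩ := (((tendsto_zero_iff_norm_tendsto_zero.2 hlim).eventually
    hloc.sublevel_mem_nhds_zero).and (eventually_ge_atTop 0)).exists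
  have hfin := ExitTime.freeTimeValue_lt_top (c := c) hsys hcost hxG hu hT
    (hx.mono Icc_subset_Ici_self) hxT
  have heq := ExitTime.exitValue_eq_freeTimeValue (g := g) (c := c) hsys hK hxG
  have hiff := fun u => ExitTime.isOptimalControl_iff (g := g) (c := c) (u := u) hsys hK hxG
  obtain ⟨w, S, hwS⟩ := ExitTime.exists_isOptimalPair hsys hK hcost hconv hxG hfin
  exact ⟨heq ▸ hfin, heq, ⟨w, (hiff w).2 ⟨S, hwS⟩⟩, ⟨w, S, hwS⟩, hiff⟩
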